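/- **Basic invariants of $H_4$.** For $x=(x_1,x_2,x_3,x_4)\in\mathbb C^4$ put $\epsilon_1=x_2^2+x_3^2+x_4^2$, $\epsilon_2=x_2^2x_3^2+x_2^2x_4^2+x_3^2x_4^2$, $\epsilon_3=x_2^2x_3^2x_4^2$, $\delta=(x_2^2-x_3^2)(x_2^2-x_4^2)(x_3^2-x_4^2)$, and $$h_2=\epsilon_1,\quad h_6=\sqrt5\,\delta+\epsilon_1\epsilon_2-11\epsilon_3,\quad h_{10}=95\epsilon_2\epsilon_3-32\epsilon_1^2\epsilon_3-5\epsilon_1\epsilon_2^2+2\epsilon_1^3\epsilon_2+3\sqrt5\,\delta\epsilon_2 .$$ Let $y_1,y_2,y_3,y_4$ be the following polynomials of degrees $30,20,12,2$ in $x$ (a standard set of basic invariants of the Coxeter group $H_4$): $$\begin{aligned} y_1={}&\tfrac{32}{3}x_1^{24}h_2^3-40x_1^{22}(2h_2^4+3h_2h_6)+x_1^{20}(360h_{10}+\tfrac{1344}{5}h_2^5+672h_2^2h_6)\\ &+x_1^{18}(1080h_6^2-1608h_2^3h_6-\tfrac{1328}{3}h_2^6-2880h_{10}h_2)\\ &+x_1^{16}(10024h_{10}h_2^2+272h_2^7+1248h_2^4h_6-5628h_2h_6^2)\\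 &+x_1^{14}(18588h_2^2h_6^2+272h_2^8-7620h_{10}h_6-16856h_{10}h_2^3)\\ &+x_1^{12}(14216h_{10}h_2^4+23508h_{10}h_6h_2-\tfrac{1328}{3}h_2^9-1248h_6h_2^6-27396h_6^2h_2^3-5796h_6^3)\\ &+x_1^{10}(3240h_{10}^2-7160h_{10}h_2^5-25332h_{10}h_6h_2^2+\tfrac{1344}{5}h_2^{10}+1608h_2^7h_6+19968h_2^4h_6^2+7350h_2h_6^3)\\ &+x_1^8(2144h_{10}h_2^6-3232h_{10}^2h_2+10908h_{10}h_2^3h_6-906h_{10}h_6^2-80h_2^{11}-672h_2^8h_6-6924h_2^5h_6^2-1956h_2^2h_6^3)\\ &+x_1^6(1168h_{10}^2h_2^2-344h_{10}h_2^7-2172h_{10}h_2^4h_6-1908h_{10}h_2h_6^2+\tfrac{32}{3}h_2^{12}+120h_2^9h_6+1332h_2^6h_6^2+288h_2^3h_6^3+2394h_6^4)\\ &+x_1^4(348h_{10}^2h_6-152h_{10}^2h_2^3+16h_{10}h_2^8+60h_{10}h_6h_2^5+408h_{10}h_6^2h_2^2-84h_2^7h_6^2+84h_2^4h_6^3-909h_2h_6^4)\\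 &+x_1^2(8h_{10}^2h_2^4-42h_{10}h_6^2h_2^3-87h_{10}h_6^3-6h_2^5h_6^3+135h_2^2h_6^4)+\tfrac43h_{10}^3-3h_{10}h_2h_6^3+\tfrac95h_6^5,\\ y_2={}&4x_1^{16}h_2^2-10x_1^{14}(2h_2^3+3h_6)+x_1^{12}(44h_2^4+138h_2h_6)+x_1^{10}(180h_{10}-44h_2^5-402h_2^2h_6)\\ &+x_1^8(44h_2^6-464h_{10}h_2+402h_2^3h_6+294h_6^2)+x_1^6(296h_{10}h_2^2-20h_2^7-138h_2^4h_6-306h_2h_6^2)\\ &+x_1^4(4h_2^8-76h_{10}h_2^3-114h_{10}h_6+30h_2^5h_6+168h_2^2h_6^2)+x_1^2(4h_{10}h_2^4-21h_2^3h_6^2+\tfrac{57}{2}h_6^3)+h_{10}^2-\tfrac32h_2h_6^3,\\ y_3={}&-2x_1^{10}h_2+6x_1^8h_2^2+x_1^6(33h_6-14h_2^3)-x_1^4(33h_2h_6-6h_2^4)+x_1^2(11h_{10}-2h_2^5)-h_{10}h_2+\tfrac32h_6^2,\\ y_4={}&x_1^2+h_2 . \end{aligned}$$ **The Frobenius manifold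 $H_4(1)$.** Let $U\subseteq\mathbb C^4$ be open, with coordinates $t=(t_1,t_2,t_3,t_4)$, and let $Z=Z(t)$ be a holomorphic function on $U$ with $Z^2=4t_4(t_4^5-3t_3)+t_2$. Let $$\begin{aligned}F(t)={}&t_1t_2t_3+\tfrac12t_1^2t_4+\tfrac{3356}{665}t_4^{21}+\tfrac{64}{5}t_3t_4^{16}+\tfrac{472}{11}t_3^2t_4^{11}+\tfrac{16}{3}t_3^3t_4^6+28t_3^4t_4-\tfrac{16}{15}t_2t_4^{15}\\&+8t_2t_3t_4^{10}+32t_2t_3^2t_4^5-\tfrac83t_2t_3^3+\tfrac{19}{18}t_2^2t_4^9-t_2^2t_3t_4^4+\tfrac16t_2^3t_4^3+\tfrac1{105}Z^7,\end{aligned}$$ $c_{ijk}=\partial^3F/\partial t_i\partial t_j\partial t_k$, $\eta_{ij}=c_{ij1}$, $(\eta^{ij})=(\eta_{ij})^{-1}$, $c^{ij}_k=\sum_{l,m}\eta^{im}\eta^{jl}c_{mlk}$. Let $E=t_1\partial_{t_1}+\frac35t_2\partial_{t_2}+\frac12t_3\partial_{t_3}+\frac1{10}t_4\partial_{t_4}$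 be the Euler vector field, $d=\frac9{10}$ the charge, and $g^{ij}(t)=\sum_lE^lc^{ij}_l(t)$ the intersection form. Flat coordinates of $g$ on an open set $V\subseteq U$ are holomorphic functions $x=(x_1,\dots,x_4)$ on $V$ with $\sum_{k,l}g^{kl}\frac{\partial x_i}{\partial t_k}\frac{\partial x_j}{\partial t_l}=\delta_{ij}$ and $E(x_i)=\frac{1-d}2x_i$. **Theorem.** Consider the relations $$\begin{aligned} y_1(x)={}&\tfrac{2^{30}5^9}{3}\bigl(27t_2^2Z-1800t_1t_3-6800t_3^3-648t_2t_3t_4Z+3888t_3^2t_4^2Z+12600t_2t_3t_4^4+6120t_1t_4^5\\ &\quad+190320t_3^2t_4^5+216t_2t_4^6Z-2592t_3t_4^7Z-42840t_2t_4^9-953520t_3t_4^{10}+432t_4^{12}Z+1309136t_4^{15}\bigr),\\ y_2(x)={}&2^{20}5^7\bigl(3t_1+38t_3^2-21t_2t_4^4-460t_3t_4^5+950t_4^{10}\bigr),\\ y_3(x)={}&2^{11}5^4\bigl(3t_2+44t_3t_4-260t_4^6\bigr),\\ y_4(x)={}&40t_4 . \end{aligned}\tag{$*$}$$ 1. Every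 nonempty open subset of $U$ contains a nonempty open subset $W$ on which there are flat coordinates $x=x(t)$ of $g$ satisfying $(*)$ for all $t\in W$ (with $Z=Z(t)$). 2. If $V\subseteq U$ is open and connected and $x$ are any flat coordinates of $g$ on $V$, then there is a constant complex orthogonal matrix $A$ such that the flat coordinates $Ax$ satisfy $(*)$ for all $t\in V$. -/

import Mathlib

noncomputable section

namespace AlgFrobenius

/-! ### Potentials, metric, structure constants and intersection form

Everything is written in coordinates `t = (t₁, …, tₙ)`, indexed by `Fin n` (so `t₁` is `t 0`). -/

/-- The partial derivative `∂f/∂tᵢ`. -/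
def pderiv {n : ℕ} (i : Fin n) (f : (Fin n → ℂ) → ℂ) (t : Fin n → ℂ) : ℂ :=
  fderiv ℂ f t (Pi.single i 1)

/-- `c_{ijk} = ∂³F/∂tᵢ∂tⱼ∂tₖ`. -/
def cLower {n : ℕ} (F : (Fin n → ℂ) → ℂ) (i j k : Fin n) (t : Fin n → ℂ) : ℂ :=
  pderiv i (pderiv j (pderiv k F)) t

/-- The metric `η_{ij} = ∂³F/∂tᵢ∂tⱼ∂t₁`. -/
def eta {n : ℕ} [NeZero n] (F : (Fin n → ℂ) → ℂ) (t : Fin n → ℂ) : Matrix (Fin n) (Fin n) ℂ :=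
  Matrix.of fun i j => cLower F i j 0 t

/-- `c^i_{jk} = ∑_l η^{il} c_{ljk}`, where `η^{ij}` is the inverse matrix of `η_{ij}`. -/
def cMixed {n : ℕ} [NeZero n] (F : (Fin n → ℂ) → ℂ) (i j k : Fin n) (t : Fin n → ℂ) : ℂ :=
  ∑ l, (eta F t)⁻¹ i l * cLower F l j k t

/-- `c^{ij}_k = ∑_l η^{jl} c^i_{lk}`. -/
def cUpper {n : ℕ} [NeZero n] (F : (Fin n → ℂ) → ℂ) (i j k : Fin n) (t : Fin n → ℂ) : ℂ :=
  ∑ l, (eta F t)⁻¹ j l * cMixed F i l k t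

/-- The intersection form `g^{ij}(t) = ∑_l E^l c^{ij}_l` for the diagonal Euler vector field
`E = ∑_l d_l t_l ∂_{t_l}`. -/
def intersectionForm {n : ℕ} [NeZero n] (F : (Fin n → ℂ) → ℂ) (deg : Fin n → ℂ)
    (t : Fin n → ℂ) : Matrix (Fin n) (Fin n) ℂ :=
  Matrix.of fun i j => ∑ l, deg l * t l * cUpper F i j l t

/-- `x = (x₁, …, xₙ)` are (holomorphic) flat coordinates on `U` of the intersection form of the
potential `F` with degrees `deg` and charge `d`: in these coordinates `g^{ij}(x) = δ^{ij}` and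
`E = (1 - d)/2 ∑ xᵢ ∂_{xᵢ}`. The first condition forces the Jacobian matrix of `x` to be
invertible at every point of `U`. -/
structure IsFlatCoordinates {n : ℕ} [NeZero n] (F : (Fin n → ℂ) → ℂ) (deg : Fin n → ℂ) (d : ℂ)
    (U : Set (Fin n → ℂ)) (x : (Fin n → ℂ) → Fin n → ℂ) : Prop where
  analytic : AnalyticOnNhd ℂ x U
  orthonormal : ∀ t ∈ U, ∀ i j,
    ∑ k, ∑ l, intersectionForm F deg t k l *
      pderiv k (fun s => x s i) t * pderiv l (fun s => x s j) t = if i = j then 1 else 0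
  euler : ∀ t ∈ U, ∀ i,
    ∑ k, deg k * t k * pderiv k (fun s => x s i) t = (1 - d) / 2 * x t i

/-! ### The basic invariants of `H₄`

Here `x = (x₁, x₂, x₃, x₄) = (x 0, x 1, x 2, x 3)`. -/

/-- `√5` as a complex number. -/
def sqrt5 : ℂ := ((Real.sqrt 5 : ℝ) : ℂ)

def eps1 (x : Fin 4 → ℂ) : ℂ := x 1 ^ 2 + x 2 ^ 2 + x 3 ^ 2

def eps2 (x : Fin 4 → ℂ) : ℂ :=
  x 1 ^ 2 * x 2 ^ 2 + x 1 ^ 2 * x 3 ^ 2 + x 2 ^ 2 * x 3 ^ 2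

def eps3 (x : Fin 4 → ℂ) : ℂ := x 1 ^ 2 * x 2 ^ 2 * x 3 ^ 2

def delta (x : Fin 4 → ℂ) : ℂ :=
  (x 1 ^ 2 - x 2 ^ 2) * (x 1 ^ 2 - x 3 ^ 2) * (x 2 ^ 2 - x 3 ^ 2)

def h2 (x : Fin 4 → ℂ) : ℂ := eps1 x

def h6 (x : Fin 4 → ℂ) : ℂ := sqrt5 * delta x + eps1 x * eps2 x - 11 * eps3 x

def h10 (x : Fin 4 → ℂ) : ℂ :=
  95 * eps2 x * eps3 x - 32 * eps1 x ^ 2 * eps3 x - 5 * eps1 x * eps2 x ^ 2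
    + 2 * eps1 x ^ 3 * eps2 x + 3 * sqrt5 * delta x * eps2 x

/-- The basic invariant of degree 30, as a polynomial in `x₁, h₂, h₆, h₁₀`. -/
def y1Poly (x1 h2 h6 h10 : ℂ) : ℂ :=
  32 / 3 * x1 ^ 24 * h2 ^ 3 - 40 * x1 ^ 22 * (2 * h2 ^ 4 + 3 * h2 * h6)
  + x1 ^ 20 * (360 * h10 + 1344 / 5 * h2 ^ 5 + 672 * h2 ^ 2 * h6)
  + x1 ^ 18 * (1080 * h6 ^ 2 - 1608 * h2 ^ 3 * h6 - 1328 / 3 * h2 ^ 6 - 2880 * h10 * h2)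
  + x1 ^ 16 * (10024 * h10 * h2 ^ 2 + 272 * h2 ^ 7 + 1248 * h2 ^ 4 * h6 - 5628 * h2 * h6 ^ 2)
  + x1 ^ 14 * (18588 * h2 ^ 2 * h6 ^ 2 + 272 * h2 ^ 8 - 7620 * h10 * h6 - 16856 * h10 * h2 ^ 3)
  + x1 ^ 12 * (14216 * h10 * h2 ^ 4 + 23508 * h10 * h6 * h2 - 1328 / 3 * h2 ^ 9
      - 1248 * h6 * h2 ^ 6 - 27396 * h6 ^ 2 * h2 ^ 3 - 5796 * h6 ^ 3)
  + x1 ^ 10 * (3240 * h10 ^ 2 - 7160 * h10 * h2 ^ 5 - 25332 * h10 * h6 * h2 ^ 2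
      + 1344 / 5 * h2 ^ 10 + 1608 * h2 ^ 7 * h6 + 19968 * h2 ^ 4 * h6 ^ 2 + 7350 * h2 * h6 ^ 3)
  + x1 ^ 8 * (2144 * h10 * h2 ^ 6 - 3232 * h10 ^ 2 * h2 + 10908 * h10 * h2 ^ 3 * h6
      - 906 * h10 * h6 ^ 2 - 80 * h2 ^ 11 - 672 * h2 ^ 8 * h6 - 6924 * h2 ^ 5 * h6 ^ 2
      - 1956 * h2 ^ 2 * h6 ^ 3)
  + x1 ^ 6 * (1168 * h10 ^ 2 * h2 ^ 2 - 344 * h10 * h2 ^ 7 - 2172 * h10 * h2 ^ 4 * h6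
      - 1908 * h10 * h2 * h6 ^ 2 + 32 / 3 * h2 ^ 12 + 120 * h2 ^ 9 * h6 + 1332 * h2 ^ 6 * h6 ^ 2
      + 288 * h2 ^ 3 * h6 ^ 3 + 2394 * h6 ^ 4)
  + x1 ^ 4 * (348 * h10 ^ 2 * h6 - 152 * h10 ^ 2 * h2 ^ 3 + 16 * h10 * h2 ^ 8
      + 60 * h10 * h6 * h2 ^ 5 + 408 * h10 * h6 ^ 2 * h2 ^ 2 - 84 * h2 ^ 7 * h6 ^ 2
      + 84 * h2 ^ 4 * h6 ^ 3 - 909 * h2 * h6 ^ 4)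
  + x1 ^ 2 * (8 * h10 ^ 2 * h2 ^ 4 - 42 * h10 * h6 ^ 2 * h2 ^ 3 - 87 * h10 * h6 ^ 3
      - 6 * h2 ^ 5 * h6 ^ 3 + 135 * h2 ^ 2 * h6 ^ 4)
  + 4 / 3 * h10 ^ 3 - 3 * h10 * h2 * h6 ^ 3 + 9 / 5 * h6 ^ 5

/-- The basic invariant of degree 20, as a polynomial in `x₁, h₂, h₆, h₁₀`. -/
def y2Poly (x1 h2 h6 h10 : ℂ) : ℂ :=
  4 * x1 ^ 16 * h2 ^ 2 - 10 * x1 ^ 14 * (2 * h2 ^ 3 + 3 * h6)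
  + x1 ^ 12 * (44 * h2 ^ 4 + 138 * h2 * h6)
  + x1 ^ 10 * (180 * h10 - 44 * h2 ^ 5 - 402 * h2 ^ 2 * h6)
  + x1 ^ 8 * (44 * h2 ^ 6 - 464 * h10 * h2 + 402 * h2 ^ 3 * h6 + 294 * h6 ^ 2)
  + x1 ^ 6 * (296 * h10 * h2 ^ 2 - 20 * h2 ^ 7 - 138 * h2 ^ 4 * h6 - 306 * h2 * h6 ^ 2)
  + x1 ^ 4 * (4 * h2 ^ 8 - 76 * h10 * h2 ^ 3 - 114 * h10 * h6 + 30 * h2 ^ 5 * h6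
      + 168 * h2 ^ 2 * h6 ^ 2)
  + x1 ^ 2 * (4 * h10 * h2 ^ 4 - 21 * h2 ^ 3 * h6 ^ 2 + 57 / 2 * h6 ^ 3)
  + h10 ^ 2 - 3 / 2 * h2 * h6 ^ 3

/-- The basic invariant of degree 12, as a polynomial in `x₁, h₂, h₆, h₁₀`. -/
def y3Poly (x1 h2 h6 h10 : ℂ) : ℂ :=
  -2 * x1 ^ 10 * h2 + 6 * x1 ^ 8 * h2 ^ 2 + x1 ^ 6 * (33 * h6 - 14 * h2 ^ 3)
  - x1 ^ 4 * (33 * h2 * h6 - 6 * h2 ^ 4) + x1 ^ 2 * (11 * h10 - 2 * h2 ^ 5)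
  - h10 * h2 + 3 / 2 * h6 ^ 2

/-- The basic invariants `y₁, y₂, y₃, y₄` of `H₄`, of degrees `30, 20, 12, 2`. -/
def y1 (x : Fin 4 → ℂ) : ℂ := y1Poly (x 0) (h2 x) (h6 x) (h10 x)

def y2 (x : Fin 4 → ℂ) : ℂ := y2Poly (x 0) (h2 x) (h6 x) (h10 x)

def y3 (x : Fin 4 → ℂ) : ℂ := y3Poly (x 0) (h2 x) (h6 x) (h10 x)

def y4 (x : Fin 4 → ℂ) : ℂ := x 0 ^ 2 + h2 x

/-! ### The algebraic Frobenius manifold `H₄(1)` -/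

/-- `Z` is a holomorphic branch on `U` of the algebraic function `Z² = 4t₄(t₄⁵ - 3t₃) + t₂`. -/
structure IsBranch (U : Set (Fin 4 → ℂ)) (Z : (Fin 4 → ℂ) → ℂ) : Prop where
  analytic : AnalyticOnNhd ℂ Z U
  equation : ∀ t ∈ U, Z t ^ 2 - 4 * t 3 * (t 3 ^ 5 - 3 * t 2) - t 1 = 0

/-- The expression of the prepotential through `t₁, t₂, t₃, t₄` and `Z`. -/
def prepotentialPoly (t1 t2 t3 t4 Z : ℂ) : ℂ :=
  t1 * t2 * t3 + 1 / 2 * t1 ^ 2 * t4 + 3356 / 665 * t4 ^ 21 + 64 / 5 * t3 * t4 ^ 16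
  + 472 / 11 * t3 ^ 2 * t4 ^ 11 + 16 / 3 * t3 ^ 3 * t4 ^ 6 + 28 * t3 ^ 4 * t4
  - 16 / 15 * t2 * t4 ^ 15 + 8 * t2 * t3 * t4 ^ 10 + 32 * t2 * t3 ^ 2 * t4 ^ 5
  - 8 / 3 * t2 * t3 ^ 3 + 19 / 18 * t2 ^ 2 * t4 ^ 9 - t2 ^ 2 * t3 * t4 ^ 4
  + 1 / 6 * t2 ^ 3 * t4 ^ 3 + 1 / 105 * Z ^ 7

/-- The prepotential of `H₄(1)`, as a function of `t`, for a given branch `Z = Z(t)`. -/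
def prepotential (Z : (Fin 4 → ℂ) → ℂ) (t : Fin 4 → ℂ) : ℂ :=
  prepotentialPoly (t 0) (t 1) (t 2) (t 3) (Z t)

/-- The degrees `1, 3/5, 1/2, 1/10` in the Euler vector field of `H₄(1)`. -/
def degrees : Fin 4 → ℂ := ![1, 3 / 5, 1 / 2, 1 / 10]

/-- The charge `9/10` of `H₄(1)`. -/
def charge : ℂ := 9 / 10

/-- The polynomial expressing `y₁` through `t` and `Z`. -/
def y1OfT (t1 t2 t3 t4 Z : ℂ) : ℂ :=
  2 ^ 30 * 5 ^ 9 / 3 * (27 * t2 ^ 2 * Z - 1800 * t1 * t3 - 6800 * t3 ^ 3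
    - 648 * t2 * t3 * t4 * Z + 3888 * t3 ^ 2 * t4 ^ 2 * Z + 12600 * t2 * t3 * t4 ^ 4
    + 6120 * t1 * t4 ^ 5 + 190320 * t3 ^ 2 * t4 ^ 5 + 216 * t2 * t4 ^ 6 * Z
    - 2592 * t3 * t4 ^ 7 * Z - 42840 * t2 * t4 ^ 9 - 953520 * t3 * t4 ^ 10
    + 432 * t4 ^ 12 * Z + 1309136 * t4 ^ 15)

/-- The polynomial expressing `y₂` through `t`. -/
def y2OfT (t1 t2 t3 t4 : ℂ) : ℂ :=
  2 ^ 20 * 5 ^ 7 * (3 * t1 + 38 * t3 ^ 2 - 21 * t2 * t4 ^ 4 - 460 * t3 * t4 ^ 5 + 950 * t4 ^ 10)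

/-- The polynomial expressing `y₃` through `t`. -/
def y3OfT (t2 t3 t4 : ℂ) : ℂ :=
  2 ^ 11 * 5 ^ 4 * (3 * t2 + 44 * t3 * t4 - 260 * t4 ^ 6)

/-- The relations between the basic invariants of `H₄` at `x` and the point `(t, Z)`. -/
def Relations (x t : Fin 4 → ℂ) (Z : ℂ) : Prop :=
  y1 x = y1OfT (t 0) (t 1) (t 2) (t 3) Z ∧
  y2 x = y2OfT (t 0) (t 1) (t 2) (t 3) ∧
  y3 x = y3OfT (t 1) (t 2) (t 3) ∧
  y4 x = 40 * t 3

end AlgFrobenius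

end

/-! Write y = `inv x` for the basic invariants and r(t) = `rel Z t` for the right-hand sides of (*).
Inner products of gradients of invariants are again invariants, so the products of the ∇y_a are
G_ab(y) for a polynomial matrix G (`gram`, `sum_pderiv_inv`). On the branch, the differentials of r
have the same products with respect to the intersection form g: J_r g J_rᵀ = G(r)
(`IsBranch.jac_rel`). So wherever y(x(t)) = r(t) and det G(r(t)) ≠ 0, the invertible Jacobian of
`inv` cancels and leaves J_x g J_xᵀ = 1; the Euler condition follows from y₄ = ∑ xᵢ² and g^{4k} =
E^k (`isFlatCoordinates_of_inv_eq_rel`).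

Existence therefore needs, in each open set, a point t with det G(r(t)) ≠ 0, and a preimage of r(t)
under `inv`. The point comes from weighted homogeneity, which degenerates the question to t =
(1,0,0,0), Z = 0 (`exists_det_gram_relOf_ne_zero`). The preimage (`exists_inv_eq`) exists because
`inv` is homogeneous in each component and vanishes only at 0, hence is proper with closed range;
its range is also open at points with det G ≠ 0, and on a complex line the points with det G ≠ 0
form a connected set. A local inverse of `inv` composed with r is then x.

For uniqueness, the transition map between two systems of flat coordinates has orthogonal Jacobian,
hence constant Jacobian, as for any isometry of flat space; the Euler condition rules out
translations. Given flat coordinates thus agree locally, up to an orthogonal A, with the constructed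
ones, and the identity theorem spreads (*) over the connected set V.

The large polynomial identities are checked on integer coefficient lists evaluated by the kernel. -/

noncomputable section

namespace AlgFrobenius

/-! ### Integer polynomials in four variables with kernel-computable arithmetic -/
namespace IntPoly

/-! ### Dense coefficient lists over an arbitrary coefficient type. -/

section Dense

variable {α : Type}

/-- `List.map`, as a recursor. -/
def listMap (f : α → α) (p : List α) : List α := List.rec [] (fun a _ ih => f a :: ih) p

/-- Sum of two coefficient lists. -/
def listAdd (add : α → α → α) (p : List α) : List α → List α :=
  List.rec (fun q => q)
    (fun a p ih q => List.rec (a :: p) (fun b q _ => add a b :: ih q) q) p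

/-- Product of two coefficient lists. -/
def listMul (add mul : α → α → α) (zero : α) (p q : List α) : List α :=
  List.rec [] (fun a _ ih => listAdd add (listMap (mul a) q) (zero :: ih)) p

/-- Formal derivative of a coefficient list. -/
def listDeriv (add : α → α → α) (zero : α) (p : List α) : List α :=
  List.rec [] (fun _ p ih => listAdd add p (zero :: ih)) p

/-- Value of a coefficient list at `x`, where `ev` evaluates the coefficients. -/
def listEval (ev : α → ℂ) (x : ℂ) : List α → ℂ
  | [] => 0
  | a :: p => ev a + x * listEval ev x p

/-- The operations are written with bare recursors so that the kernel can evaluate them; their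
defining equations are recovered by `rfl`. -/
theorem listMap_cons (f : α → α) (a : α) (p : List α) :
    listMap f (a :: p) = f a :: listMap f p := rfl

theorem listAdd_nil_right (add : α → α → α) (p : List α) : listAdd add p [] = p := by
  cases p <;> rfl

theorem listAdd_cons (add : α → α → α) (a b : α) (p q : List α) :
    listAdd add (a :: p) (b :: q) = add a b :: listAdd add p q := rfl

theorem listMul_cons (add mul : α → α → α) (zero a : α) (p q : List α) :
    listMul add mul zero (a :: p) q
      = listAdd add (listMap (mul a) q) (zero :: listMul add mul zero p q) := rfl

theorem listDeriv_cons (add : α → α → α) (zero a : α) (p : List α) :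
    listDeriv add zero (a :: p) = listAdd add p (zero :: listDeriv add zero p) := rfl

theorem listEval_add {add : α → α → α} {ev : α → ℂ} (h : ∀ a b, ev (add a b) = ev a + ev b)
    (x : ℂ) (p q : List α) :
    listEval ev x (listAdd add p q) = listEval ev x p + listEval ev x q := by
  induction p generalizing q with
  | nil => exact (zero_add _).symm
  | cons a p ih =>
    cases q with
    | nil => simp [listAdd_nil_right, listEval]
    | cons b q => simp only [listAdd_cons, listEval, h, ih]; ring

theorem listEval_map_mul {mul : α → α → α} {ev : α → ℂ} (h : ∀ a b, ev (mul a b) = ev a * ev b)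
    (x : ℂ) (a : α) (q : List α) :
    listEval ev x (listMap (mul a) q) = ev a * listEval ev x q := by
  induction q with
  | nil => exact (mul_zero _).symm
  | cons b q ih => simp only [listMap_cons, listEval, h, ih]; ring

theorem listEval_mul {add mul : α → α → α} {zero : α} {ev : α → ℂ}
    (hadd : ∀ a b, ev (add a b) = ev a + ev b) (hmul : ∀ a b, ev (mul a b) = ev a * ev b)
    (hzero : ev zero = 0) (x : ℂ) (p q : List α) :
    listEval ev x (listMul add mul zero p q) = listEval ev x p * listEval ev x q := by
  induction p with
  | nil => exact (zero_mul _).symm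
  | cons a p ih =>
    simp only [listMul_cons, listEval_add hadd, listEval_map_mul hmul, listEval, hzero, ih]; ring

theorem listEval_comp (ev : α → ℂ) (f : α → α) (c x : ℂ) (p : List α) :
    listEval (fun a => c * ev (f a)) x p = c * listEval ev x (listMap f p) := by
  induction p with
  | nil => exact (mul_zero _).symm
  | cons a p ih => simp only [listEval, listMap_cons, ih]; ring

theorem listEval_sum (e₁ e₂ : α → ℂ) (x : ℂ) (p : List α) :
    listEval (fun a => e₁ a + e₂ a) x p = listEval e₁ x p + listEval e₂ x p := by
  induction p with
  | nil => simp [listEval]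
  | cons a p ih => simp only [listEval, ih]; ring

/-- The product rule for a + x p. The values of the coefficients also move with s, so the lemma can
be applied once per variable to nested lists. -/
theorem hasDerivAt_listEval {add : α → α → α} {zero : α} {ev : ℂ → α → ℂ} {ev' : α → ℂ} {r : ℂ}
    (hadd : ∀ a b, ev r (add a b) = ev r a + ev r b) (hzero : ev r zero = 0)
    (hev : ∀ a, HasDerivAt (fun s => ev s a) (ev' a) r) {x : ℂ → ℂ} {x' : ℂ}
    (hx : HasDerivAt x x' r) (p : List α) :
    HasDerivAt (fun s => listEval (ev s) (x s) p)
      (listEval ev' (x r) p + x' * listEval (ev r) (x r) (listDeriv add zero p)) r := by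
  induction p with
  | nil => exact (hasDerivAt_const r (0 : ℂ)).congr_deriv (by simp [listEval, listDeriv])
  | cons a p ih =>
    simp only [listEval, listDeriv_cons, listEval_add hadd, hzero]
    refine ((hev a).fun_add (hx.fun_mul ih)).congr_deriv ?_
    ring

theorem analyticAt_listEval {E : Type*} [NormedAddCommGroup E] [NormedSpace ℂ E]
    {ev : E → α → ℂ} {x : E → ℂ} {u : E} (hev : ∀ a, AnalyticAt ℂ (fun v => ev v a) u)
    (hx : AnalyticAt ℂ x u) (p : List α) : AnalyticAt ℂ (fun v => listEval (ev v) (x v) p) u := by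
  induction p with
  | nil => exact analyticAt_const
  | cons a p ih => exact (hev a).fun_add (hx.fun_mul ih)

theorem listEval_eq_zero {isZero : α → Bool} {ev : α → ℂ} (h : ∀ a, isZero a = true → ev a = 0)
    (x : ℂ) (p : List α) (hp : p.all isZero = true) : listEval ev x p = 0 := by
  induction p with
  | nil => rfl
  | cons a p ih =>
    simp only [List.all_cons, Bool.and_eq_true] at hp
    simp [listEval, h a hp.1, ih hp.2]

end Dense

/-- Sparse univariate polynomials: lists of exponents and coefficients. -/
abbrev Sparse := List (ℕ × ℤ)

/-! ### Arithmetic of sparse univariate polynomials. -/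

namespace Sparse

/-- Add one monomial. -/
def insert (e : ℕ) (c : ℤ) (p : Sparse) : Sparse :=
  List.rec [(e, c)]
    (fun m p ih => bif Nat.beq e m.1 then (e, Int.add c m.2) :: p else m :: ih) p

/-- Sum. -/
def add (p q : Sparse) : Sparse := List.rec q (fun m _ ih => insert m.1 m.2 ih) p

/-- Product. -/
def mul (p q : Sparse) : Sparse :=
  List.rec [] (fun m _ ih => add (listMap (fun n => (Nat.add m.1 n.1, Int.mul m.2 n.2)) q) ih) p

/-- Formal derivative. -/
def derivative (p : Sparse) : Sparse :=
  listMap (fun m => (Nat.pred m.1, Int.mul (Int.ofNat m.1) m.2)) p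

/-- Value at `v`. -/
def eval (v : ℂ) : Sparse → ℂ
  | [] => 0
  | m :: p => m.2 * v ^ m.1 + eval v p

/-- All coefficients vanish. -/
def isZero (p : Sparse) : Bool := p.all fun m => Int.beq' m.2 0

theorem insert_cons (e : ℕ) (c : ℤ) (m : ℕ × ℤ) (p : Sparse) :
    insert e c (m :: p) = bif Nat.beq e m.1 then (e, Int.add c m.2) :: p else m :: insert e c p :=
  rfl

theorem add_cons (m : ℕ × ℤ) (p q : Sparse) : add (m :: p) q = insert m.1 m.2 (add p q) := rfl

theorem mul_cons (m : ℕ × ℤ) (p q : Sparse) : mul (m :: p) q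
    = add (listMap (fun n => (Nat.add m.1 n.1, Int.mul m.2 n.2)) q) (mul p q) := rfl

theorem eval_insert (v : ℂ) (e : ℕ) (c : ℤ) (p : Sparse) :
    eval v (insert e c p) = c * v ^ e + eval v p := by
  induction p with
  | nil => simp [insert, eval]
  | cons m p ih =>
    by_cases h : Nat.beq e m.1 = true
    · have he := Nat.eq_of_beq_eq_true h
      have : Int.add c m.2 = c + m.2 := rfl
      rw [insert_cons, h, cond_true]
      simp only [eval, this, he]; push_cast; ring
    · simp only [Bool.not_eq_true] at h
      simp only [insert_cons, h, cond_false, eval, ih]; ring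

theorem eval_add (v : ℂ) (p q : Sparse) : eval v (add p q) = eval v p + eval v q := by
  induction p with
  | nil => exact (zero_add _).symm
  | cons m p ih => simp only [add_cons, eval_insert, ih, eval]; ring

theorem eval_map_mul (v : ℂ) (m : ℕ × ℤ) (q : Sparse) :
    eval v (listMap (fun n => (Nat.add m.1 n.1, Int.mul m.2 n.2)) q) = (m.2 * v ^ m.1) * eval v q := by
  induction q with
  | nil => exact (mul_zero _).symm
  | cons n q ih =>
    have h₁ : Nat.add m.1 n.1 = m.1 + n.1 := rfl
    have h₂ : Int.mul m.2 n.2 = m.2 * n.2 := rfl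
    simp only [listMap_cons, eval, h₁, h₂, ih]; push_cast; ring

theorem eval_mul (v : ℂ) (p q : Sparse) : eval v (mul p q) = eval v p * eval v q := by
  induction p with
  | nil => exact (zero_mul _).symm
  | cons m p ih => simp only [mul_cons, eval_add, eval_map_mul, ih, eval]; ring

theorem eval_eq_zero (v : ℂ) (p : Sparse) (hp : isZero p = true) : eval v p = 0 := by
  induction p with
  | nil => rfl
  | cons m p ih =>
    simp only [isZero, List.all_cons, Bool.and_eq_true] at hp
    have : m.2 = 0 := by simpa using hp.1
    simp [eval, this, ih hp.2]

theorem hasDerivAt_eval {v : ℂ → ℂ} {v' r : ℂ} (hv : HasDerivAt v v' r) (p : Sparse) :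
    HasDerivAt (fun s => eval (v s) p) (v' * eval (v r) (derivative p)) r := by
  induction p with
  | nil => exact (hasDerivAt_const r (0 : ℂ)).congr_deriv (by simp [eval, derivative, listMap])
  | cons m p ih =>
    have h₁ : Int.mul (Int.ofNat m.1) m.2 = (m.1 : ℤ) * m.2 := rfl
    have h₂ : Nat.pred m.1 = m.1 - 1 := rfl
    simp only [eval, derivative, listMap_cons, h₁, h₂]
    refine (((hv.fun_pow m.1).const_mul (m.2 : ℂ)).fun_add ih).congr_deriv ?_
    push_cast
    simp only [derivative]
    ring

end Sparse

/-- Polynomials in four variables: dense in the last three, sparse in the first. -/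
def Poly := List (List (List Sparse))

/-! ### Four-variable polynomials, their evaluation and formal derivatives. -/

namespace Poly

def add₁ := listAdd Sparse.add

def add₂ := listAdd add₁

def add₃ := listAdd add₂

def mul₁ := listMul Sparse.add Sparse.mul []

def mul₂ := listMul add₁ mul₁ []

def mul₃ := listMul add₂ mul₂ []

/-- The constant polynomial `c`. -/
def C (c : ℤ) : Poly := [[[[(0, c)]]]]

/-- The four variables. -/
def X : Fin 4 → Poly
  | 0 => [[[[(1, 1)]]]]
  | 1 => [[[[], [(0, 1)]]]]
  | 2 => [[[], [[(0, 1)]]]]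
  | 3 => [[], [[[(0, 1)]]]]

/-- Power. -/
def pow (p : Poly) : ℕ → Poly
  | 0 => C 1
  | 1 => p
  | n + 2 => mul₃ (pow p (n + 1)) p

instance : Add Poly := ⟨add₃⟩

instance : Mul Poly := ⟨mul₃⟩

instance : Pow Poly ℕ := ⟨pow⟩

instance : Sub Poly := ⟨fun p q => add₃ p (mul₃ (C (-1)) q)⟩

/-- Formal partial derivatives. -/
def D : Fin 4 → Poly → Poly
  | 0 => listMap (listMap (listMap Sparse.derivative))
  | 1 => listMap (listMap (listDeriv Sparse.add []))
  | 2 => listMap (listDeriv add₁ [])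
  | 3 => listDeriv add₂ []

/-- All coefficients vanish. -/
def isZero (p : Poly) : Bool := List.all p fun q => q.all fun r => r.all Sparse.isZero

def eval₁ (u : Fin 4 → ℂ) := listEval (Sparse.eval (u 0)) (u 1)

def eval₂ (u : Fin 4 → ℂ) := listEval (eval₁ u) (u 2)

/-- Value at `u`. -/
def eval (u : Fin 4 → ℂ) (p : Poly) : ℂ := listEval (eval₂ u) (u 3) p

section

variable (u : Fin 4 → ℂ)

theorem eval₁_add (p q : List Sparse) : eval₁ u (add₁ p q) = eval₁ u p + eval₁ u q :=
  listEval_add (Sparse.eval_add _) _ p q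

theorem eval₂_add (p q : List (List Sparse)) : eval₂ u (add₂ p q) = eval₂ u p + eval₂ u q :=
  listEval_add (eval₁_add u) _ p q

theorem eval₁_mul (p q : List Sparse) : eval₁ u (mul₁ p q) = eval₁ u p * eval₁ u q :=
  listEval_mul (Sparse.eval_add _) (Sparse.eval_mul _) rfl _ p q

theorem eval₂_mul (p q : List (List Sparse)) : eval₂ u (mul₂ p q) = eval₂ u p * eval₂ u q :=
  listEval_mul (eval₁_add u) (eval₁_mul u) rfl _ p q

theorem eval_add (p q : Poly) : eval u (p + q) = eval u p + eval u q :=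
  listEval_add (eval₂_add u) _ p q

theorem eval_mul (p q : Poly) : eval u (p * q) = eval u p * eval u q :=
  listEval_mul (eval₂_add u) (eval₂_mul u) rfl _ p q

theorem eval_C (c : ℤ) : eval u (C c) = c := by
  simp [eval, eval₂, eval₁, C, listEval, Sparse.eval]

theorem eval_X (i : Fin 4) : eval u (X i) = u i := by
  fin_cases i <;> simp [eval, eval₂, eval₁, X, listEval, Sparse.eval]

theorem eval_sub (p q : Poly) : eval u (p - q) = eval u p - eval u q := by
  have : eval u (p - q) = eval u (p + C (-1) * q) := rfl
  rw [this, eval_add, eval_mul, eval_C]; push_cast; ring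

theorem eval_pow (p : Poly) (n : ℕ) : eval u (p ^ n) = eval u p ^ n := by
  change eval u (pow p n) = _
  induction n using Nat.twoStepInduction with
  | zero => exact (eval_C u 1).trans (by simp)
  | one => simp [pow]
  | more n _ ih => rw [pow, pow_succ _ (n + 1), ← ih]; exact eval_mul u _ _

/-- The passage from computation to analysis: a Boolean test on coefficients gives an identity at
every complex point. No normal form is needed, since stored zero coefficients are harmless. -/
theorem eval_eq_of_isZero_sub {p q : Poly} (h : isZero (p - q) = true) : eval u p = eval u q :=
  sub_eq_zero.1 <| (eval_sub u p q).symm.trans <|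
    listEval_eq_zero (listEval_eq_zero (listEval_eq_zero (Sparse.eval_eq_zero _) _) _) _ _ h

end

theorem hasDerivAt_eval {u : ℂ → Fin 4 → ℂ} {u' : Fin 4 → ℂ} {r : ℂ}
    (hu : ∀ i, HasDerivAt (fun s => u s i) (u' i) r) (p : Poly) :
    HasDerivAt (fun s => eval (u s) p) (∑ i, eval (u r) (D i p) * u' i) r := by
  have h₁ (p : List Sparse) : HasDerivAt (fun s => eval₁ (u s) p)
      (u' 0 * eval₁ (u r) (listMap Sparse.derivative p)
        + u' 1 * eval₁ (u r) (listDeriv Sparse.add [] p)) r :=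
    (hasDerivAt_listEval (ev := fun s => Sparse.eval (u s 0)) (Sparse.eval_add _) rfl
      (Sparse.hasDerivAt_eval (hu 0)) (hu 1) p).congr_deriv (by rw [listEval_comp]; rfl)
  have h₂ (p : List (List Sparse)) : HasDerivAt (fun s => eval₂ (u s) p)
      (u' 0 * eval₂ (u r) (listMap (listMap Sparse.derivative) p)
        + u' 1 * eval₂ (u r) (listMap (listDeriv Sparse.add []) p)
        + u' 2 * eval₂ (u r) (listDeriv add₁ [] p)) r :=
    (hasDerivAt_listEval (zero := []) (ev := fun s => eval₁ (u s)) (eval₁_add _) rfl h₁ (hu 2) p).congr_deriv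
      (by rw [listEval_sum, listEval_comp, listEval_comp]; rfl)
  have h₃ (p : List (List (List Sparse))) : HasDerivAt (fun s => eval (u s) p)
      (u' 0 * eval (u r) (listMap (listMap (listMap Sparse.derivative)) p)
        + u' 1 * eval (u r) (listMap (listMap (listDeriv Sparse.add [])) p)
        + u' 2 * eval (u r) (listMap (listDeriv add₁ []) p)
        + u' 3 * eval (u r) (listDeriv add₂ [] p)) r :=
    (hasDerivAt_listEval (zero := []) (ev := fun s => eval₂ (u s)) (eval₂_add _) rfl h₂ (hu 3)
      p).congr_deriv
      (by rw [listEval_sum, listEval_sum, listEval_comp, listEval_comp, listEval_comp]; rfl)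
  refine (h₃ p).congr_deriv ?_
  simp only [Fin.sum_univ_four, mul_comm _ (u' _)]
  rfl

theorem analyticAt_eval (u : Fin 4 → ℂ) (p : Poly) : AnalyticAt ℂ (fun v => eval v p) u := by
  have (i : Fin 4) : AnalyticAt ℂ (fun s : Fin 4 → ℂ => s i) u :=
    (ContinuousLinearMap.proj (R := ℂ) (φ := fun _ : Fin 4 => ℂ) i).analyticAt u
  refine analyticAt_listEval (analyticAt_listEval (analyticAt_listEval ?_ (this 1)) (this 2))
    (this 3) p
  intro q
  induction q with
  | nil => exact analyticAt_const
  | cons m q ih => exact (analyticAt_const.fun_mul ((this 0).fun_pow m.1)).fun_add ih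

end Poly

end IntPoly

open Filter Topology
open scoped ContDiff

/-! ### Partial derivatives -/

section Pderiv

variable {n : ℕ} {f g : (Fin n → ℂ) → ℂ} {t : Fin n → ℂ}

theorem hasDerivAt_line (hf : DifferentiableAt ℂ f t) (i : Fin n) :
    HasDerivAt (fun r : ℂ => f (t + r • Pi.single i 1)) (pderiv i f t) 0 := by
  have h : HasDerivAt (fun r : ℂ => t + r • (Pi.single i 1 : Fin n → ℂ)) (Pi.single i 1) 0 := by
    simpa using ((hasDerivAt_id (0 : ℂ)).smul_const (Pi.single i (1 : ℂ))).const_add t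
  have hf' : HasFDerivAt f (fderiv ℂ f t) (t + (0 : ℂ) • (Pi.single i 1 : Fin n → ℂ)) := by
    simpa using hf.hasFDerivAt
  exact hf'.comp_hasDerivAt 0 h

theorem pderiv_eq_of_line {i : Fin n} {d : ℂ} (hf : DifferentiableAt ℂ f t)
    (h : HasDerivAt (fun r : ℂ => f (t + r • Pi.single i 1)) d 0) : pderiv i f t = d :=
  (hasDerivAt_line hf i).unique h

theorem fderiv_eq_sum (v : Fin n → ℂ) : fderiv ℂ f t v = ∑ i, v i * pderiv i f t := by
  conv_lhs => rw [pi_eq_sum_univ' v]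
  simp [map_sum, pderiv, Pi.single]

theorem pderiv_congr (i : Fin n) (h : f =ᶠ[𝓝 t] g) : pderiv i f t = pderiv i g t := by
  rw [pderiv, pderiv, h.fderiv_eq]

theorem pderiv_const (i : Fin n) (c : ℂ) : pderiv i (fun _ => c) t = 0 := by
  simp [pderiv]

theorem pderiv_apply (i j : Fin n) : pderiv i (fun s => s j) t = if j = i then 1 else 0 := by
  have := (hasFDerivAt_apply (𝕜 := ℂ) j t).fderiv
  rw [pderiv, this]
  simp [Pi.single_apply]

theorem pderiv_add (i : Fin n) (hf : DifferentiableAt ℂ f t) (hg : DifferentiableAt ℂ g t) :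
    pderiv i (fun s => f s + g s) t = pderiv i f t + pderiv i g t := by
  rw [pderiv, fderiv_fun_add hf hg]; rfl

theorem pderiv_sub (i : Fin n) (hf : DifferentiableAt ℂ f t) (hg : DifferentiableAt ℂ g t) :
    pderiv i (fun s => f s - g s) t = pderiv i f t - pderiv i g t := by
  rw [pderiv, fderiv_fun_sub hf hg]; rfl

theorem pderiv_mul (i : Fin n) (hf : DifferentiableAt ℂ f t) (hg : DifferentiableAt ℂ g t) :
    pderiv i (fun s => f s * g s) t = f t * pderiv i g t + g t * pderiv i f t := by
  rw [pderiv, fderiv_fun_mul hf hg]; rfl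

theorem pderiv_pow (i : Fin n) (hf : DifferentiableAt ℂ f t) (m : ℕ) :
    pderiv i (fun s => f s ^ m) t = m * f t ^ (m - 1) * pderiv i f t := by
  rw [pderiv, fderiv_fun_pow m hf]; simp [pderiv]

theorem pderiv_sum {ι : Type*} (i : Fin n) (s : Finset ι) {F : ι → (Fin n → ℂ) → ℂ}
    (hF : ∀ k ∈ s, DifferentiableAt ℂ (F k) t) :
    pderiv i (fun r => ∑ k ∈ s, F k r) t = ∑ k ∈ s, pderiv i (F k) t := by
  rw [pderiv, fderiv_fun_sum hF]; simp [pderiv]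

theorem pderiv_comp {m : ℕ} {F : (Fin m → ℂ) → ℂ} {φ : (Fin n → ℂ) → Fin m → ℂ} (i : Fin n)
    (hF : DifferentiableAt ℂ F (φ t)) (hφ : DifferentiableAt ℂ φ t) :
    pderiv i (fun s => F (φ s)) t = ∑ k, pderiv k F (φ t) * pderiv i (fun s => φ s k) t := by
  have h := (hF.hasFDerivAt.comp t hφ.hasFDerivAt).fderiv
  have h' (k : Fin m) : pderiv i (fun s => φ s k) t = fderiv ℂ φ t (Pi.single i 1) k := by
    rw [pderiv, ((hasFDerivAt_pi'.1 hφ.hasFDerivAt) k).fderiv]; rfl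
  change fderiv ℂ (F ∘ φ) t _ = _
  rw [h]
  simp only [h', ContinuousLinearMap.comp_apply, fderiv_eq_sum, mul_comm]

theorem analyticAt_pderiv (i : Fin n) (hf : AnalyticAt ℂ f t) : AnalyticAt ℂ (pderiv i f) t :=
  AnalyticAt.comp
    (g := ContinuousLinearMap.apply ℂ ℂ (Pi.single i (1 : ℂ) : Fin n → ℂ))
    (ContinuousLinearMap.analyticAt _ _) hf.fderiv

theorem pderiv_comm (i j : Fin n) (hf : AnalyticAt ℂ f t) :
    pderiv i (pderiv j f) t = pderiv j (pderiv i f) t := by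
  have hd : DifferentiableAt ℂ (fderiv ℂ f) t := hf.fderiv.differentiableAt
  have key (i j : Fin n) : pderiv i (pderiv j f) t
      = fderiv ℂ (fderiv ℂ f) t (Pi.single i 1) (Pi.single j 1) := by
    change fderiv ℂ (fun s => fderiv ℂ f s (Pi.single j 1)) t _ = _
    rw [fderiv_clm_apply hd (differentiableAt_const _)]
    simp
  rw [key, key]
  exact (hf.contDiffAt (n := 2)).isSymmSndFDerivAt (by simp) _ _

theorem pderiv_eval (i : Fin n) {ψ : (Fin n → ℂ) → Fin 4 → ℂ}
    (hψ : ∀ k, DifferentiableAt ℂ (fun s => ψ s k) t) (p : IntPoly.Poly) :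
    pderiv i (fun s => IntPoly.Poly.eval (ψ s) p) t
      = ∑ k, IntPoly.Poly.eval (ψ t) (IntPoly.Poly.D k p) * pderiv i (fun s => ψ s k) t := by
  have hline := IntPoly.Poly.hasDerivAt_eval (fun k => hasDerivAt_line (hψ k) i) p
  rw [zero_smul, add_zero] at hline
  refine pderiv_eq_of_line ?_ hline
  exact DifferentiableAt.comp (g := fun u => IntPoly.Poly.eval u p) t
    (IntPoly.Poly.analyticAt_eval _ p).differentiableAt (differentiableAt_pi.2 hψ)

end Pderiv

open IntPoly IntPoly.Poly

/-! ### The invariants of `H₃` -/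

theorem sqrt5_sq : sqrt5 ^ 2 = 5 := by
  rw [sqrt5, ← Complex.ofReal_pow, Real.sq_sqrt (by norm_num)]; norm_num

/-- The functions `h₂`, `x₁²`, `h₆`, `h₁₀`. -/
def base (x : Fin 4 → ℂ) : Fin 4 → ℂ := ![h2 x, x 0 ^ 2, h6 x, h10 x]

theorem differentiable_eps1 : Differentiable ℂ eps1 := by unfold eps1; fun_prop

theorem differentiable_eps2 : Differentiable ℂ eps2 := by unfold eps2; fun_prop

theorem differentiable_eps3 : Differentiable ℂ eps3 := by unfold eps3; fun_prop

theorem differentiable_delta : Differentiable ℂ delta := by unfold delta; fun_prop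

theorem differentiable_base (k : Fin 4) : Differentiable ℂ fun x => base x k := by
  have := differentiable_eps1
  have := differentiable_eps2
  have := differentiable_eps3
  have := differentiable_delta
  fin_cases k <;> simp [base, h2, h6, h10] <;> fun_prop

theorem pderiv_eps1 (x : Fin 4 → ℂ) (i : Fin 4) :
    pderiv i eps1 x = ![0, 2 * x 1, 2 * x 2, 2 * x 3] i := by
  rw [show eps1 = fun s => s 1 ^ 2 + s 2 ^ 2 + s 3 ^ 2 from rfl]
  fin_cases i <;> simp (disch := fun_prop) [pderiv_add, pderiv_pow, pderiv_apply]

theorem pderiv_eps2 (x : Fin 4 → ℂ) (i : Fin 4) :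
    pderiv i eps2 x = ![0, 2 * x 1 * (x 2 ^ 2 + x 3 ^ 2), 2 * x 2 * (x 1 ^ 2 + x 3 ^ 2),
      2 * x 3 * (x 1 ^ 2 + x 2 ^ 2)] i := by
  rw [show eps2 = fun s => s 1 ^ 2 * s 2 ^ 2 + s 1 ^ 2 * s 3 ^ 2 + s 2 ^ 2 * s 3 ^ 2 from rfl]
  fin_cases i <;>
    simp (disch := fun_prop) [pderiv_add, pderiv_mul, pderiv_pow, pderiv_apply] <;> ring

theorem pderiv_eps3 (x : Fin 4 → ℂ) (i : Fin 4) :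
    pderiv i eps3 x = ![0, 2 * x 1 * (x 2 ^ 2 * x 3 ^ 2), 2 * x 2 * (x 1 ^ 2 * x 3 ^ 2),
      2 * x 3 * (x 1 ^ 2 * x 2 ^ 2)] i := by
  rw [show eps3 = fun s => s 1 ^ 2 * s 2 ^ 2 * s 3 ^ 2 from rfl]
  fin_cases i <;>
    simp (disch := fun_prop) [pderiv_mul, pderiv_pow, pderiv_apply] <;> ring

/-- The gradient of `δ`. -/
def gradDelta (x : Fin 4 → ℂ) : Fin 4 → ℂ :=
  ![0, 2 * x 1 * ((2 * x 1 ^ 2 - x 2 ^ 2 - x 3 ^ 2) * (x 2 ^ 2 - x 3 ^ 2)),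
    2 * x 2 * ((x 1 ^ 2 + x 3 ^ 2 - 2 * x 2 ^ 2) * (x 3 ^ 2 - x 1 ^ 2) * (-1)),
    2 * x 3 * ((2 * x 3 ^ 2 - x 1 ^ 2 - x 2 ^ 2) * (x 1 ^ 2 - x 2 ^ 2))]

theorem pderiv_delta (x : Fin 4 → ℂ) (i : Fin 4) : pderiv i delta x = gradDelta x i := by
  rw [show delta = fun s => (s 1 ^ 2 - s 2 ^ 2) * (s 1 ^ 2 - s 3 ^ 2) * (s 2 ^ 2 - s 3 ^ 2)
    from rfl]
  fin_cases i <;>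
    simp (disch := fun_prop) [gradDelta, pderiv_mul, pderiv_sub, pderiv_pow, pderiv_apply] <;> ring

theorem pderiv_h6 (x : Fin 4 → ℂ) (i : Fin 4) :
    pderiv i h6 x = sqrt5 * pderiv i delta x + (eps1 x * pderiv i eps2 x + eps2 x * pderiv i eps1 x)
      - 11 * pderiv i eps3 x := by
  have := differentiable_eps1 x
  have := differentiable_eps2 x
  have := differentiable_eps3 x
  have := differentiable_delta x
  rw [show h6 = fun s => sqrt5 * delta s + eps1 s * eps2 s - 11 * eps3 s from rfl]
  simp (disch := fun_prop) [pderiv_add, pderiv_sub, pderiv_mul, pderiv_const]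

theorem pderiv_h10 (x : Fin 4 → ℂ) (i : Fin 4) :
    pderiv i h10 x = 3 * sqrt5 * (delta x * pderiv i eps2 x + eps2 x * pderiv i delta x)
      + (95 * eps2 x - 32 * eps1 x ^ 2) * pderiv i eps3 x
      + (95 * eps3 x - 10 * eps1 x * eps2 x + 2 * eps1 x ^ 3) * pderiv i eps2 x
      + (-64 * eps1 x * eps3 x - 5 * eps2 x ^ 2 + 6 * eps1 x ^ 2 * eps2 x) * pderiv i eps1 x := by
  have := differentiable_eps1 x
  have := differentiable_eps2 x
  have := differentiable_eps3 x
  have := differentiable_delta x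
  rw [show h10 = fun s => 95 * eps2 s * eps3 s - 32 * eps1 s ^ 2 * eps3 s - 5 * eps1 s * eps2 s ^ 2
    + 2 * eps1 s ^ 3 * eps2 s + 3 * sqrt5 * delta s * eps2 s from rfl]
  simp (disch := fun_prop) [pderiv_add, pderiv_sub, pderiv_mul, pderiv_pow, pderiv_const]
  ring

/-- Inner products of the gradients of `h₂`, `x₁²`, `h₆`, `h₁₀`. -/
def baseGram : Fin 4 → Fin 4 → Poly
  | 0, 0 => C 4 * X 0
  | 0, 1 => C 0
  | 0, 2 => C 12 * X 2
  | 0, 3 => C 20 * X 3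
  | 1, 0 => C 0
  | 1, 1 => C 4 * X 1
  | 1, 2 => C 0
  | 1, 3 => C 0
  | 2, 0 => C 12 * X 2
  | 2, 1 => C 0
  | 2, 2 => C 8 * X 0 ^ 2 * X 2 + C 8 * X 3
  | 2, 3 => C 8 * X 0 ^ 4 * X 2 + C 28 * X 0 * X 2 ^ 2
  | 3, 0 => C 20 * X 3
  | 3, 1 => C 0
  | 3, 2 => C 8 * X 0 ^ 4 * X 2 + C 28 * X 0 * X 2 ^ 2
  | 3, 3 => C 8 * X 0 ^ 4 * X 3 + C 36 * X 0 ^ 3 * X 2 ^ 2 + C 30 * X 2 ^ 3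

theorem baseGram_comm (k l : Fin 4) : baseGram k l = baseGram l k := by
  fin_cases k <;> fin_cases l <;> rfl

/-- The products of gradients are invariant under H₃, so they are polynomials in its basic
invariants h₂, h₆, h₁₀. The function x₁² depends on the complementary variable, which makes its row
diagonal. -/
theorem sum_pderiv_base_of_le (x : Fin 4 → ℂ) (k l : Fin 4) (h : k ≤ l) :
    ∑ i, pderiv i (fun s => base s k) x * pderiv i (fun s => base s l) x
      = eval (base x) (baseGram k l) := by
  have e0 : (fun s => base s 0) = eps1 := rfl
  have e1 : (fun s => base s 1) = fun s => s 0 ^ 2 := rfl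
  have e2 : (fun s => base s 2) = h6 := rfl
  have e3 : (fun s => base s 3) = h10 := rfl
  have hsq (i : Fin 4) : pderiv i (fun s => s 0 ^ 2) x = ![2 * x 0, 0, 0, 0] i := by
    fin_cases i <;> simp (disch := fun_prop) [pderiv_pow, pderiv_apply]
  fin_cases k <;> fin_cases l <;> first | exact absurd h (by decide) | skip
  all_goals
    simp only [Fin.sum_univ_four, Fin.zero_eta, Fin.mk_one, Fin.reduceFinMk, e0, e1, e2, e3, hsq,
      pderiv_h6, pderiv_h10, pderiv_eps1, pderiv_eps2, pderiv_eps3, pderiv_delta, Matrix.cons_val]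
  all_goals
    simp only [gradDelta, baseGram, eval_add, eval_mul, eval_pow, eval_C, eval_X, base, h2, h6,
      h10, eps1, eps2, eps3, delta, Matrix.cons_val]
    push_cast
  · ring
  · ring
  · ring
  · ring
  · ring
  · ring
  · ring
  -- In the three remaining cases √5² occurs. The multiplier of √5² = 5 is its coefficient in the
  -- difference of the two sides; in the last case h₆³ also contributes √5³ = √5 · √5².
  · linear_combination 4 * ((x 1 * ((2 * x 1 ^ 2 - x 2 ^ 2 - x 3 ^ 2) * (x 2 ^ 2 - x 3 ^ 2))) ^ 2
      + (x 2 * ((x 1 ^ 2 + x 3 ^ 2 - 2 * x 2 ^ 2) * (x 1 ^ 2 - x 3 ^ 2))) ^ 2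
      + (x 3 * ((2 * x 3 ^ 2 - x 1 ^ 2 - x 2 ^ 2) * (x 1 ^ 2 - x 2 ^ 2))) ^ 2) * sqrt5_sq
  · linear_combination 12 * (x 1 * ((2 * x 1 ^ 2 - x 2 ^ 2 - x 3 ^ 2) * (x 2 ^ 2 - x 3 ^ 2))
      * ((x 1 ^ 2 - x 2 ^ 2) * (x 1 ^ 2 - x 3 ^ 2) * (x 2 ^ 2 - x 3 ^ 2) * (x 1 * (x 2 ^ 2 + x 3 ^ 2))
      + (x 1 ^ 2 * x 2 ^ 2 + x 1 ^ 2 * x 3 ^ 2 + x 2 ^ 2 * x 3 ^ 2) * (x 1 * ((2 * x 1 ^ 2 - x 2 ^ 2 - x 3 ^ 2) * (x 2 ^ 2 - x 3 ^ 2))))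
      + x 2 * ((x 1 ^ 2 + x 3 ^ 2 - 2 * x 2 ^ 2) * (x 1 ^ 2 - x 3 ^ 2))
      * ((x 1 ^ 2 - x 2 ^ 2) * (x 1 ^ 2 - x 3 ^ 2) * (x 2 ^ 2 - x 3 ^ 2) * (x 2 * (x 1 ^ 2 + x 3 ^ 2))
      + (x 1 ^ 2 * x 2 ^ 2 + x 1 ^ 2 * x 3 ^ 2 + x 2 ^ 2 * x 3 ^ 2) * (x 2 * ((x 1 ^ 2 + x 3 ^ 2 - 2 * x 2 ^ 2) * (x 1 ^ 2 - x 3 ^ 2))))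
      + x 3 * ((2 * x 3 ^ 2 - x 1 ^ 2 - x 2 ^ 2) * (x 1 ^ 2 - x 2 ^ 2))
      * ((x 1 ^ 2 - x 2 ^ 2) * (x 1 ^ 2 - x 3 ^ 2) * (x 2 ^ 2 - x 3 ^ 2) * (x 3 * (x 1 ^ 2 + x 2 ^ 2))
      + (x 1 ^ 2 * x 2 ^ 2 + x 1 ^ 2 * x 3 ^ 2 + x 2 ^ 2 * x 3 ^ 2) * (x 3 * ((2 * x 3 ^ 2 - x 1 ^ 2 - x 2 ^ 2) * (x 1 ^ 2 - x 2 ^ 2))))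
      - 28 / 12 * (x 1 ^ 2 + x 2 ^ 2 + x 3 ^ 2) * ((x 1 ^ 2 - x 2 ^ 2) * (x 1 ^ 2 - x 3 ^ 2) * (x 2 ^ 2 - x 3 ^ 2)) ^ 2) * sqrt5_sq
  · linear_combination 36 * (((x 1 ^ 2 - x 2 ^ 2) * (x 1 ^ 2 - x 3 ^ 2) * (x 2 ^ 2 - x 3 ^ 2) * (x 1 * (x 2 ^ 2 + x 3 ^ 2))
      + (x 1 ^ 2 * x 2 ^ 2 + x 1 ^ 2 * x 3 ^ 2 + x 2 ^ 2 * x 3 ^ 2) * (x 1 * ((2 * x 1 ^ 2 - x 2 ^ 2 - x 3 ^ 2) * (x 2 ^ 2 - x 3 ^ 2)))) ^ 2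
      + ((x 1 ^ 2 - x 2 ^ 2) * (x 1 ^ 2 - x 3 ^ 2) * (x 2 ^ 2 - x 3 ^ 2) * (x 2 * (x 1 ^ 2 + x 3 ^ 2))
      + (x 1 ^ 2 * x 2 ^ 2 + x 1 ^ 2 * x 3 ^ 2 + x 2 ^ 2 * x 3 ^ 2) * (x 2 * ((x 1 ^ 2 + x 3 ^ 2 - 2 * x 2 ^ 2) * (x 1 ^ 2 - x 3 ^ 2)))) ^ 2
      + ((x 1 ^ 2 - x 2 ^ 2) * (x 1 ^ 2 - x 3 ^ 2) * (x 2 ^ 2 - x 3 ^ 2) * (x 3 * (x 1 ^ 2 + x 2 ^ 2))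
      + (x 1 ^ 2 * x 2 ^ 2 + x 1 ^ 2 * x 3 ^ 2 + x 2 ^ 2 * x 3 ^ 2) * (x 3 * ((2 * x 3 ^ 2 - x 1 ^ 2 - x 2 ^ 2) * (x 1 ^ 2 - x 2 ^ 2)))) ^ 2) * sqrt5_sq
      - (36 * (x 1 ^ 2 + x 2 ^ 2 + x 3 ^ 2) ^ 3 * ((x 1 ^ 2 - x 2 ^ 2) * (x 1 ^ 2 - x 3 ^ 2) * (x 2 ^ 2 - x 3 ^ 2)) ^ 2
        + 30 * (sqrt5 * ((x 1 ^ 2 - x 2 ^ 2) * (x 1 ^ 2 - x 3 ^ 2) * (x 2 ^ 2 - x 3 ^ 2)) ^ 3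
          + 3 * ((x 1 ^ 2 - x 2 ^ 2) * (x 1 ^ 2 - x 3 ^ 2) * (x 2 ^ 2 - x 3 ^ 2)) ^ 2
            * ((x 1 ^ 2 + x 2 ^ 2 + x 3 ^ 2) * (x 1 ^ 2 * x 2 ^ 2 + x 1 ^ 2 * x 3 ^ 2 + x 2 ^ 2 * x 3 ^ 2)
              - 11 * (x 1 ^ 2 * x 2 ^ 2 * x 3 ^ 2)))) * sqrt5_sq

theorem sum_pderiv_base (x : Fin 4 → ℂ) (k l : Fin 4) :
    ∑ i, pderiv i (fun s => base s k) x * pderiv i (fun s => base s l) x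
      = eval (base x) (baseGram k l) := by
  rcases le_total k l with h | h
  · exact sum_pderiv_base_of_le x k l h
  · simp only [mul_comm (pderiv _ (fun s => base s k) x), baseGram_comm k l,
      sum_pderiv_base_of_le x l k h]

/-! ### The Gram matrix of the invariants of `H₄` -/

/-- `15 y₁`, `2 y₂`, `2 y₃`, `y₄` as polynomials in `h₂`, `x₁²`, `h₆`, `h₁₀`. -/
def invPoly : Fin 4 → Poly
  | 0 => X 1 ^ 12 * (C 160 * X 0 ^ 3)
    + X 1 ^ 11 * (C (-1200) * X 0 ^ 4 + C (-1800) * X 0 * X 2)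
    + X 1 ^ 10 * (C 4032 * X 0 ^ 5 + C 10080 * X 0 ^ 2 * X 2 + C 5400 * X 3)
    + X 1 ^ 9 * (C (-6640) * X 0 ^ 6 + C (-24120) * X 0 ^ 3 * X 2 + C (-43200) * X 0 * X 3 + C 16200 * X 2 ^ 2)
    + X 1 ^ 8 * (C 4080 * X 0 ^ 7 + C 18720 * X 0 ^ 4 * X 2 + C 150360 * X 0 ^ 2 * X 3 + C (-84420) * X 0 * X 2 ^ 2)
    + X 1 ^ 7 * (C 4080 * X 0 ^ 8 + C (-252840) * X 0 ^ 3 * X 3 + C 278820 * X 0 ^ 2 * X 2 ^ 2 + C (-114300) * X 2 * X 3)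
    + X 1 ^ 6 * (C (-6640) * X 0 ^ 9 + C (-18720) * X 0 ^ 6 * X 2 + C 213240 * X 0 ^ 4 * X 3 + C (-410940) * X 0 ^ 3 * X 2 ^ 2 + C 352620 * X 0 * X 2 * X 3 + C (-86940) * X 2 ^ 3)
    + X 1 ^ 5 * (C 4032 * X 0 ^ 10 + C 24120 * X 0 ^ 7 * X 2 + C (-107400) * X 0 ^ 5 * X 3 + C 299520 * X 0 ^ 4 * X 2 ^ 2 + C (-379980) * X 0 ^ 2 * X 2 * X 3 + C 110250 * X 0 * X 2 ^ 3 + C 48600 * X 3 ^ 2)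
    + X 1 ^ 4 * (C (-1200) * X 0 ^ 11 + C (-10080) * X 0 ^ 8 * X 2 + C 32160 * X 0 ^ 6 * X 3 + C (-103860) * X 0 ^ 5 * X 2 ^ 2 + C 163620 * X 0 ^ 3 * X 2 * X 3 + C (-29340) * X 0 ^ 2 * X 2 ^ 3 + C (-48480) * X 0 * X 3 ^ 2 + C (-13590) * X 2 ^ 2 * X 3)
    + X 1 ^ 3 * (C 160 * X 0 ^ 12 + C 1800 * X 0 ^ 9 * X 2 + C (-5160) * X 0 ^ 7 * X 3 + C 19980 * X 0 ^ 6 * X 2 ^ 2 + C (-32580) * X 0 ^ 4 * X 2 * X 3 + C 4320 * X 0 ^ 3 * X 2 ^ 3 + C 17520 * X 0 ^ 2 * X 3 ^ 2 + C (-28620) * X 0 * X 2 ^ 2 * X 3 + C 35910 * X 2 ^ 4)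
    + X 1 ^ 2 * (C 240 * X 0 ^ 8 * X 3 + C (-1260) * X 0 ^ 7 * X 2 ^ 2 + C 900 * X 0 ^ 5 * X 2 * X 3 + C 1260 * X 0 ^ 4 * X 2 ^ 3 + C (-2280) * X 0 ^ 3 * X 3 ^ 2 + C 6120 * X 0 ^ 2 * X 2 ^ 2 * X 3 + C (-13635) * X 0 * X 2 ^ 4 + C 5220 * X 2 * X 3 ^ 2)
    + X 1 * (C (-90) * X 0 ^ 5 * X 2 ^ 3 + C 120 * X 0 ^ 4 * X 3 ^ 2 + C (-630) * X 0 ^ 3 * X 2 ^ 2 * X 3 + C 2025 * X 0 ^ 2 * X 2 ^ 4 + C (-1305) * X 2 ^ 3 * X 3)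
    + (C (-45) * X 0 * X 2 ^ 3 * X 3 + C 27 * X 2 ^ 5 + C 20 * X 3 ^ 3)
  | 1 => X 1 ^ 8 * (C 8 * X 0 ^ 2)
    + X 1 ^ 7 * (C (-40) * X 0 ^ 3 + C (-60) * X 2)
    + X 1 ^ 6 * (C 88 * X 0 ^ 4 + C 276 * X 0 * X 2)
    + X 1 ^ 5 * (C (-88) * X 0 ^ 5 + C (-804) * X 0 ^ 2 * X 2 + C 360 * X 3)
    + X 1 ^ 4 * (C 88 * X 0 ^ 6 + C 804 * X 0 ^ 3 * X 2 + C (-928) * X 0 * X 3 + C 588 * X 2 ^ 2)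
    + X 1 ^ 3 * (C (-40) * X 0 ^ 7 + C (-276) * X 0 ^ 4 * X 2 + C 592 * X 0 ^ 2 * X 3 + C (-612) * X 0 * X 2 ^ 2)
    + X 1 ^ 2 * (C 8 * X 0 ^ 8 + C 60 * X 0 ^ 5 * X 2 + C (-152) * X 0 ^ 3 * X 3 + C 336 * X 0 ^ 2 * X 2 ^ 2 + C (-228) * X 2 * X 3)
    + X 1 * (C 8 * X 0 ^ 4 * X 3 + C (-42) * X 0 ^ 3 * X 2 ^ 2 + C 57 * X 2 ^ 3)
    + (C (-3) * X 0 * X 2 ^ 3 + C 2 * X 3 ^ 2)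
  | 2 => X 1 ^ 5 * (C (-4) * X 0)
    + X 1 ^ 4 * (C 12 * X 0 ^ 2)
    + X 1 ^ 3 * (C (-28) * X 0 ^ 3 + C 66 * X 2)
    + X 1 ^ 2 * (C 12 * X 0 ^ 4 + C (-66) * X 0 * X 2)
    + X 1 * (C (-4) * X 0 ^ 5 + C 22 * X 3)
    + (C (-2) * X 0 * X 3 + C 3 * X 2 ^ 2)
  | 3 => X 1 + X 0

/-- The numbers `15`, `2`, `2`, `1`. -/
def invScale : Fin 4 → ℤ := ![15, 2, 2, 1]

/-- The invariants are even in x₁, so x₁² can serve as a variable. The scales 15, 2, 2, 1 clear the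
denominators. -/
theorem eval_invPoly (u : Fin 4 → ℂ) (x₁ : ℂ) (h : u 1 = x₁ ^ 2) (a : Fin 4) :
    eval u (invPoly a) = invScale a * ![y1Poly x₁ (u 0) (u 2) (u 3), y2Poly x₁ (u 0) (u 2) (u 3),
      y3Poly x₁ (u 0) (u 2) (u 3), x₁ ^ 2 + u 0] a := by
  fin_cases a <;>
  simp [invPoly, invScale, eval_add, eval_mul, eval_pow, eval_C, eval_X, h, y1Poly, y2Poly,
      y3Poly] <;>
  ring

/-- Sum of four polynomials. -/
def sum4 (f : Fin 4 → Poly) : Poly := f 0 + (f 1 + (f 2 + f 3))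

/-- Inner product of the gradients of two polynomials with respect to the Gram matrix `g`. -/
def pairing (g : Fin 4 → Fin 4 → Poly) (p q : Poly) : Poly :=
  sum4 fun i => D i p * sum4 fun j => g i j * D j q

/-- `30` times the Gram matrix, in the variables `15 y₁`, `2 y₂`, `2 y₃`, `y₄`, scaled. -/
def gramPoly (y : Fin 4 → Poly) : Fin 4 → Fin 4 → Poly
  | 0, 0 => y 0 * (y 3 ^ 2 * (C 3600 * y 1 * y 3 ^ 2 + C 2700 * y 2 ^ 2))
      + y 1 * (y 2 * (y 3 * (C 8100 * y 1 * y 3 ^ 2 + C 13050 * y 2 ^ 2)))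
  | 0, 1 => y 2 * (y 3 ^ 2 * (C (-360) * y 0 * y 3 + C (-1260) * y 1 * y 2) + C (-180) * y 2 ^ 3)
      + C 1080 * y 1 ^ 2 * y 3 ^ 4
  | 0, 2 => y 3 ^ 2 * (C (-240) * y 0 * y 3 ^ 3 + y 2 * (C (-360) * y 1 * y 3 ^ 2 + C (-60) * y 2 ^ 2))
      + C (-1800) * y 1 ^ 2
  | 0, 3 => C 180 * y 0
  | 1, 0 => y 2 * (y 3 ^ 2 * (C (-360) * y 0 * y 3 + C (-1260) * y 1 * y 2) + C (-180) * y 2 ^ 3)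
      + C 1080 * y 1 ^ 2 * y 3 ^ 4
  | 1, 1 => y 3 * (y 3 ^ 2 * (C 16 * y 0 * y 3 + C (-168) * y 1 * y 2) + C 76 * y 2 ^ 3)
  | 1, 2 => C (-24) * y 0 + y 3 ^ 3 * (C (-144) * y 1 * y 3 ^ 2 + C 24 * y 2 ^ 2)
  | 1, 3 => C 120 * y 1
  | 2, 0 => y 3 ^ 2 * (C (-240) * y 0 * y 3 ^ 3 + y 2 * (C (-360) * y 1 * y 3 ^ 2 + C (-60) * y 2 ^ 2))
      + C (-1800) * y 1 ^ 2
  | 2, 1 => C (-24) * y 0 + y 3 ^ 3 * (C (-144) * y 1 * y 3 ^ 2 + C 24 * y 2 ^ 2)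
  | 2, 2 => y 3 * (C 264 * y 1 + C (-48) * y 2 * y 3 ^ 4)
  | 2, 3 => C 72 * y 2
  | 3, 0 => C 180 * y 0
  | 3, 1 => C 120 * y 1
  | 3, 2 => C 72 * y 2
  | 3, 3 => C 12 * y 3

/-- The Gram matrix of the gradients of `y₁`, `y₂`, `y₃`, `y₄` as a function of their values. -/
def gram (y : Fin 4 → ℂ) : Matrix (Fin 4) (Fin 4) ℂ :=
  let g01 := -120 * y 0 * y 2 * y 3 ^ 3 + 48 * y 1 ^ 2 * y 3 ^ 4 - 112 * y 1 * y 2 ^ 2 * y 3 ^ 2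
    - 32 * y 2 ^ 4
  let g02 := -40 * y 0 * y 3 ^ 5 - 80 * y 1 ^ 2 - 16 * y 1 * y 2 * y 3 ^ 4
    - 16 / 3 * y 2 ^ 3 * y 3 ^ 2
  let g12 := -30 * y 0 - 24 * y 1 * y 3 ^ 5 + 8 * y 2 ^ 2 * y 3 ^ 3
  !![160 * y 0 * y 1 * y 3 ^ 4 + 240 * y 0 * y 2 ^ 2 * y 3 ^ 2 + 96 * y 1 ^ 2 * y 2 * y 3 ^ 3
      + 928 / 3 * y 1 * y 2 ^ 3 * y 3, g01, g02, 60 * y 0;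
    g01, 20 * y 0 * y 3 ^ 4 - 56 * y 1 * y 2 * y 3 ^ 3 + 152 / 3 * y 2 ^ 3 * y 3, g12, 40 * y 1;
    g02, g12, 44 * y 1 * y 3 - 8 * y 2 * y 3 ^ 5, 24 * y 2;
    60 * y 0, 40 * y 1, 24 * y 2, 4 * y 3]

theorem gram_comm (y : Fin 4 → ℂ) (a b : Fin 4) : gram y a b = gram y b a := by
  fin_cases a <;> fin_cases b <;> rfl

theorem eval_gramPoly {u y : Fin 4 → ℂ} {p : Fin 4 → Poly}
    (h : ∀ a, eval u (p a) = invScale a * y a) (a b : Fin 4) :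
    eval u (gramPoly p a b) = 3 * (invScale a * invScale b * gram y a b) := by
  fin_cases a <;> fin_cases b <;>
  · simp [gramPoly, gram, eval_add, eval_mul, eval_pow, eval_C, h, invScale]
    ring

theorem eval_pairing (u : Fin 4 → ℂ) (g : Fin 4 → Fin 4 → Poly) (p q : Poly) :
    eval u (pairing g p q) = ∑ k, ∑ l, eval u (D k p) * eval u (g k l) * eval u (D l q) := by
  simp only [pairing, sum4, eval_add, eval_mul, Fin.sum_univ_four]; ring

/-- The H₄ half of the computation. The factor 3 clears the denominators left in `gram`. -/
theorem isZero_gram (a b : Fin 4) (h : a ≤ b) :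
    isZero (C 3 * pairing baseGram (invPoly a) (invPoly b) - gramPoly invPoly a b) = true := by
  revert a b
  decide +kernel

/-- The basic invariants `y₁`, `y₂`, `y₃`, `y₄`. -/
def inv (x : Fin 4 → ℂ) : Fin 4 → ℂ := ![y1 x, y2 x, y3 x, y4 x]

theorem analyticAt_base (x : Fin 4 → ℂ) : AnalyticAt ℂ base x := by
  have h : ContDiff ℂ ω base := by
    rw [contDiff_pi]
    intro k
    fin_cases k <;> simp [base, h2, h6, h10, eps1, eps2, eps3, delta] <;> fun_prop
  exact h.contDiffAt.analyticAt

theorem eval_base_invPoly (x : Fin 4 → ℂ) (a : Fin 4) :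
    eval (base x) (invPoly a) = invScale a * inv x a :=
  eval_invPoly (base x) (x 0) rfl a

theorem invScale_ne_zero (a : Fin 4) : (invScale a : ℂ) ≠ 0 := by
  fin_cases a <;> simp [invScale]

theorem analyticAt_inv (x : Fin 4 → ℂ) : AnalyticAt ℂ inv x := by
  refine AnalyticAt.pi fun a => ?_
  have h : (fun s => inv s a) = fun s => (invScale a : ℂ)⁻¹ * eval (base s) (invPoly a) := by
    funext s
    rw [eval_base_invPoly, inv_mul_cancel_left₀ (invScale_ne_zero a)]
  rw [h]
  exact analyticAt_const.fun_mul (AnalyticAt.comp (g := fun u => eval u (invPoly a))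
    (analyticAt_eval _ _) (analyticAt_base x))

theorem invScale_mul_pderiv_inv (x : Fin 4 → ℂ) (i a : Fin 4) :
    invScale a * pderiv i (fun s => inv s a) x
      = ∑ k, eval (base x) (D k (invPoly a)) * pderiv i (fun s => base s k) x := by
  have hd : DifferentiableAt ℂ (fun s => inv s a) x :=
    differentiableAt_pi.1 (analyticAt_inv x).differentiableAt a
  rw [← pderiv_eval i (fun k => differentiable_base k x)]
  simp only [eval_base_invPoly]
  rw [pderiv_mul i (differentiableAt_const _) hd, pderiv_const]
  ring

theorem sum_pderiv_inv_of_le (x : Fin 4 → ℂ) (a b : Fin 4) (h : a ≤ b) :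
    ∑ i, pderiv i (fun s => inv s a) x * pderiv i (fun s => inv s b) x = gram (inv x) a b := by
  have key := eval_eq_of_isZero_sub (base x) (isZero_gram a b h)
  rw [eval_mul, eval_C, eval_pairing, eval_gramPoly (eval_base_invPoly x)] at key
  simp only [← sum_pderiv_base] at key
  have expand : ∑ k, ∑ l, eval (base x) (D k (invPoly a))
        * (∑ i, pderiv i (fun s => base s k) x * pderiv i (fun s => base s l) x)
        * eval (base x) (D l (invPoly b))
      = ∑ i, (invScale a * pderiv i (fun s => inv s a) x)
        * (invScale b * pderiv i (fun s => inv s b) x) := by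
    simp only [invScale_mul_pderiv_inv, Fin.sum_univ_four]; ring
  rw [expand] at key
  have ha := invScale_ne_zero a
  have hb := invScale_ne_zero b
  refine mul_left_cancel₀ (mul_ne_zero three_ne_zero (mul_ne_zero ha hb)) ?_
  push_cast at key
  rw [mul_assoc 3 _ (gram _ a b), ← key, Finset.mul_sum, Finset.mul_sum]
  exact Finset.sum_congr rfl fun i _ => by ring

theorem sum_pderiv_inv (x : Fin 4 → ℂ) (a b : Fin 4) :
    ∑ i, pderiv i (fun s => inv s a) x * pderiv i (fun s => inv s b) x = gram (inv x) a b := by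
  rcases le_total a b with h | h
  · exact sum_pderiv_inv_of_le x a b h
  · rw [gram_comm, ← sum_pderiv_inv_of_le x b a h]
    exact Finset.sum_congr rfl fun i _ => mul_comm _ _

/-! ### Surjectivity of the basic invariants -/

/-- The degrees of the basic invariants. -/
def invDegree : Fin 4 → ℕ := ![30, 20, 12, 2]

theorem inv_smul (r : ℂ) (x : Fin 4 → ℂ) (a : Fin 4) :
    inv (r • x) a = r ^ invDegree a * inv x a := by
  have e₂ : h2 (r • x) = r ^ 2 * h2 x := by simp [h2, eps1]; ring
  have e₆ : h6 (r • x) = r ^ 6 * h6 x := by simp [h6, eps1, eps2, eps3, delta]; ring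
  have e₁₀ : h10 (r • x) = r ^ 10 * h10 x := by simp [h10, eps1, eps2, eps3, delta]; ring
  fin_cases a <;>
  · simp [inv, invDegree, y1, y2, y3, y4, e₂, e₆, e₁₀, y1Poly, y2Poly, y3Poly]
    ring

/-- After b = -v² is substituted, a power of v lies in the ideal of the other three invariants. Once
v = 0, the invariants y₃ and y₂ reduce to multiples of c² and d². -/
theorem yPoly_eq_zero {v b c d : ℂ} (h₁ : y1Poly v b c d = 0) (h₂ : y2Poly v b c d = 0)
    (h₃ : y3Poly v b c d = 0) (h₄ : v ^ 2 + b = 0) : v = 0 ∧ b = 0 ∧ c = 0 ∧ d = 0 := by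
  obtain rfl : b = -v ^ 2 := by linear_combination h₄
  have hv : v = 0 := by
    have : 1940805148792061952000 * v ^ 46 = 0 := by
      unfold y1Poly at h₁
      unfold y2Poly at h₂
      unfold y3Poly at h₃
      -- A Nullstellensatz certificate, weighted homogeneous of degree 46 when v, c, d have degrees
      -- 1, 6, 10; the cofactors have degrees 16, 26 and 34.
      linear_combination -(
      450381835255926600 * v ^ 16 + 868720658733542520 * v ^ 10 * c + 159712013053824390 * v ^ 6 *
      d + 19629872015876730 * v ^ 4 * c ^ 2 + 929536857675 * c * d) * h₁ - (
      -10782250826622566400 * v ^ 26 - 68287588568609587200 * v ^ 20 * c - 74015129225916770400 *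
      v ^ 16 * d - 587897687342998772880 * v ^ 14 * c ^ 2 - 175096796719983981120 * v ^ 10 * c * d
      - 1042883367545076039600 * v ^ 8 * c ^ 3 - 28047933923716906920 * v ^ 6 * d ^ 2 -
      192653486339817244200 * v ^ 4 * c ^ 2 * d - 23643305769233680500 * v ^ 2 * c ^ 4 -
      1239382476900 * c * d ^ 2) * h₂ - (
      -16391917126182484660080 * v ^ 16 * c ^ 3 + 2280580504920934236000 * v ^ 14 * d ^ 2 +
      17704946316983892922680 * v ^ 12 * c ^ 2 * d + 12442939434384366470160 * v ^ 10 * c ^ 4 -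
      269350345558905337920 * v ^ 8 * c * d ^ 2 - 1725656450973158495640 * v ^ 6 * c ^ 3 * d +
      472842559538254557924 * v ^ 4 * c ^ 5 + 2319582047748206200 * v ^ 4 * d ^ 3 +
      15762289611423188480 * v ^ 2 * c ^ 2 * d ^ 2 - 1115444229210 * c ^ 4 * d) * h₃
    simpa using this
  subst hv
  have hc : c = 0 := by simpa [y3Poly] using h₃
  subst hc
  exact ⟨rfl, by simp, rfl, by simpa [y2Poly] using h₂⟩

theorem eq_zero_of_inv_eq_zero {x : Fin 4 → ℂ} (h : inv x = 0) : x = 0 := by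
  obtain ⟨h₀, hb, hc, hd⟩ :=
    yPoly_eq_zero (congrFun h 0) (congrFun h 1) (congrFun h 2) (congrFun h 3)
  have e₁ : eps1 x = 0 := hb
  have hprod : eps2 x * eps3 x = 0 := by
    -- With ε₁ = 0, eliminating √5 δ gives h₁₀ - 3 ε₂ h₆ = (95 + 33) ε₂ ε₃.
    have : 128 * (eps2 x * eps3 x) = 0 := by
      rw [h6] at hc
      rw [h10] at hd
      linear_combination hd - 3 * eps2 x * hc
        - (-32 * eps1 x * eps3 x - 5 * eps2 x ^ 2 + 2 * eps1 x ^ 2 * eps2 x - 3 * eps2 x ^ 2) * e₁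
    simpa using this
  -- With ε₁ = 0, h₆ = 0 says √5 δ = 11 ε₃. Squaring and using that δ² is the discriminant of the
  -- cubic with roots x₂², x₃², x₄² gives the relation.
  have hdisc : 5 * (-4 * eps2 x ^ 3 - 27 * eps3 x ^ 2) = 121 * eps3 x ^ 2 := by
    have hδ : delta x ^ 2 = -4 * eps2 x ^ 3 - 27 * eps3 x ^ 2 + eps1 x * (eps1 x * eps2 x ^ 2
        - 4 * eps1 x ^ 2 * eps3 x + 18 * eps2 x * eps3 x) := by
      simp only [delta, eps1, eps2, eps3]; ring
    rw [e₁, zero_mul, add_zero] at hδ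
    rw [h6, e₁] at hc
    linear_combination (-5) * hδ + (sqrt5 * delta x + 11 * eps3 x) * hc - delta x ^ 2 * sqrt5_sq
  have e₃ : eps3 x = 0 := by
    rcases mul_eq_zero.1 hprod with h | h
    · rw [h] at hdisc
      have : eps3 x ^ 2 = 0 := by linear_combination (-1 / 256) * hdisc
      simpa using this
    · exact h
  have e₂ : eps2 x = 0 := by
    rw [e₃] at hdisc
    have : eps2 x ^ 3 = 0 := by linear_combination (-1 / 20) * hdisc
    simpa using this
  -- Each square x₂², x₃², x₄² is a root of the cubic with coefficients ε₁, ε₂, ε₃, all of which now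
  -- vanish.
  have hcube (z : ℂ) (hz : z = x 1 ∨ z = x 2 ∨ z = x 3) : z = 0 := by
    have : z ^ 6 = eps1 x * z ^ 4 - eps2 x * z ^ 2 + eps3 x := by
      simp only [eps1, eps2, eps3]
      rcases hz with rfl | rfl | rfl <;> ring
    rw [e₁, e₂, e₃] at this
    simpa using this
  funext i
  fin_cases i
  · exact h₀
  · exact hcube _ (Or.inl rfl)
  · exact hcube _ (Or.inr (Or.inl rfl))
  · exact hcube _ (Or.inr (Or.inr rfl))

theorem continuous_inv : Continuous inv :=
  continuous_iff_continuousAt.2 fun x => (analyticAt_inv x).continuousAt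

/-- On the unit sphere ‖inv‖ has a positive minimum m, because its only zero is the origin.
Component a scales by ‖x‖ to its degree, which is at least ‖x‖ once ‖x‖ ≥ 1. -/
theorem exists_le_norm_inv : ∃ m : ℝ, 0 < m ∧ ∀ x, 1 ≤ ‖x‖ → m * ‖x‖ ≤ ‖inv x‖ := by
  obtain ⟨u₀, hu₀, hmin⟩ := (isCompact_sphere (0 : Fin 4 → ℂ) 1).exists_isMinOn
    (NormedSpace.sphere_nonempty.2 zero_le_one) continuous_inv.norm.continuousOn
  have hu₀' : ‖u₀‖ = 1 := by simpa using hu₀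
  refine ⟨‖inv u₀‖, norm_pos_iff.2 fun h => ?_, fun x hx => ?_⟩
  · rw [eq_zero_of_inv_eq_zero h, norm_zero] at hu₀'
    exact zero_ne_one hu₀'
  · have hr : 0 < ‖x‖ := one_pos.trans_le hx
    have hu : ((‖x‖⁻¹ : ℝ) : ℂ) • x ∈ Metric.sphere (0 : Fin 4 → ℂ) 1 := by
      simp [norm_smul, hr.ne']
    have hx' : x = ((‖x‖ : ℝ) : ℂ) • (((‖x‖⁻¹ : ℝ) : ℂ) • x) := by
      rw [smul_smul, ← Complex.ofReal_mul, mul_inv_cancel₀ hr.ne', Complex.ofReal_one, one_smul]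
    set u := ((‖x‖⁻¹ : ℝ) : ℂ) • x
    have h₁ : ‖inv u₀‖ ≤ ‖inv u‖ := hmin hu
    have h₂ : ‖inv u‖ ≤ ‖inv x‖ / ‖x‖ := by
      have hnn : 0 ≤ ‖inv x‖ / ‖x‖ := div_nonneg (norm_nonneg _) (norm_nonneg _)
      refine (pi_norm_le_iff_of_nonneg hnn).2 fun a => ?_
      rw [le_div_iff₀ hr]
      refine le_trans ?_ (norm_le_pi_norm (inv x) a)
      conv_rhs => rw [hx', inv_smul, norm_mul, norm_pow, Complex.norm_real, norm_norm]
      rw [mul_comm]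
      refine mul_le_mul_of_nonneg_right ?_ (norm_nonneg _)
      exact le_self_pow₀ hx (by fin_cases a <;> simp [invDegree])
    calc ‖inv u₀‖ * ‖x‖ ≤ ‖inv x‖ / ‖x‖ * ‖x‖ := by gcongr; exact h₁.trans h₂
      _ = ‖inv x‖ := div_mul_cancel₀ _ hr.ne'

/-- Linear growth at infinity makes `inv` proper, and proper maps are closed. -/
theorem isClosed_range_inv : IsClosed (Set.range inv) := by
  refine (isProperMap_iff_tendsto_cocompact.2 ⟨continuous_inv, ?_⟩).isClosedMap.isClosed_range
  obtain ⟨m, hm, h⟩ := exists_le_norm_inv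
  rw [← Metric.cobounded_eq_cocompact, ← tendsto_norm_atTop_iff_cobounded]
  refine Filter.tendsto_atTop_mono' _ ?_
    (Filter.Tendsto.const_mul_atTop hm tendsto_norm_cobounded_atTop)
  filter_upwards [tendsto_norm_cobounded_atTop.eventually_ge_atTop 1] with x hx using h x hx

/-- The Jacobian matrix of a map. -/
def jac (f : (Fin 4 → ℂ) → Fin 4 → ℂ) (x : Fin 4 → ℂ) : Matrix (Fin 4) (Fin 4) ℂ :=
  Matrix.of fun a i => pderiv i (fun s => f s a) x

theorem fderiv_apply_eq_mulVec {f : (Fin 4 → ℂ) → Fin 4 → ℂ} {x : Fin 4 → ℂ}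
    (hf : DifferentiableAt ℂ f x) (v : Fin 4 → ℂ) : fderiv ℂ f x v = (jac f x).mulVec v := by
  funext a
  have h : fderiv ℂ f x v a = fderiv ℂ (fun s => f s a) x v := by
    rw [((hasFDerivAt_pi'.1 hf.hasFDerivAt) a).fderiv]; rfl
  rw [h, fderiv_eq_sum]
  simp [Matrix.mulVec, dotProduct, jac, mul_comm]

theorem det_fderiv {f : (Fin 4 → ℂ) → Fin 4 → ℂ} {x : Fin 4 → ℂ}
    (hf : DifferentiableAt ℂ f x) : (fderiv ℂ f x).det = (jac f x).det := by
  rw [← LinearMap.det_toLin']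
  change LinearMap.det (fderiv ℂ f x : (Fin 4 → ℂ) →ₗ[ℂ] (Fin 4 → ℂ)) = _
  congr 1
  exact LinearMap.ext fun v => fderiv_apply_eq_mulVec hf v

theorem jac_inv_mul_transpose (x : Fin 4 → ℂ) :
    jac inv x * (jac inv x).transpose = gram (inv x) := by
  ext a b
  rw [← sum_pderiv_inv]
  rfl

theorem det_jac_inv_ne_zero {x : Fin 4 → ℂ} (h : (gram (inv x)).det ≠ 0) :
    (jac inv x).det ≠ 0 := by
  rw [← jac_inv_mul_transpose, Matrix.det_mul] at h
  exact left_ne_zero_of_mul h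

/-- The Gram matrix is J Jᵀ, so its nondegeneracy makes J invertible and `inv` locally open. -/
theorem range_inv_mem_nhds {x : Fin 4 → ℂ} (h : (gram (inv x)).det ≠ 0) :
    Set.range inv ∈ 𝓝 (inv x) := by
  have hs := (analyticAt_inv x).hasStrictFDerivAt
  have hdet : (fderiv ℂ inv x).det ≠ 0 := by
    rw [det_fderiv (analyticAt_inv x).differentiableAt]; exact det_jac_inv_ne_zero h
  rw [← ContinuousLinearMap.coe_toContinuousLinearEquivOfDetNeZero _ hdet] at hs
  rw [← hs.map_nhds_eq_of_equiv]
  exact Filter.range_mem_map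

theorem exists_det_gram_inv_ne_zero : ∃ x, (gram (inv x)).det ≠ 0 := by
  -- The choice x₂ = x₃ makes δ vanish, so √5 disappears from the values.
  refine ⟨![3, 1, 1, 2], ?_⟩
  have h : inv ![3, 1, 1, 2] = ![384128614836000, 4339926180, -900570, 15] := by
    simp [inv, y1, y2, y3, y4, y1Poly, y2Poly, y3Poly, h2, h6, h10, eps1, eps2, eps3, delta]
    norm_num
  rw [h]
  simp [gram, Matrix.det_succ_row_zero, Fin.sum_univ_succ, Fin.succAbove]
  norm_num

theorem analyticAt_det_gram (y : Fin 4 → ℂ) : AnalyticAt ℂ (fun s => (gram s).det) y := by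
  have h : ContDiff ℂ ω fun s => (gram s).det := by
    simp only [Matrix.det_apply]
    refine ContDiff.sum fun σ _ => ContDiff.const_smul _ (contDiff_prod fun i _ => ?_)
    generalize σ i = a
    fin_cases a <;> fin_cases i <;> simp [gram] <;> fun_prop
  exact h.contDiffAt.analyticAt

/-- An open-and-closed argument on the complex line from a known value of `inv` to y, away from the
zeros of det G. Real segments would not do, as they may meet these zeros. -/
theorem exists_inv_eq {y : Fin 4 → ℂ} (hy : (gram y).det ≠ 0) : ∃ x, inv x = y := by
  obtain ⟨x₀, hx₀⟩ := exists_det_gram_inv_ne_zero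
  let line (z : ℂ) : Fin 4 → ℂ := inv x₀ + z • (y - inv x₀)
  have hline (z : ℂ) : AnalyticAt ℂ line z :=
    analyticAt_const.add (analyticAt_id.smul analyticAt_const)
  let f (z : ℂ) : ℂ := (gram (line z)).det
  have hf : AnalyticOnNhd ℂ f Set.univ := fun z _ =>
    AnalyticAt.comp (g := fun s => (gram s).det) (analyticAt_det_gram _) (hline z)
  have l0 : line 0 = inv x₀ := by simp [line]
  have l1 : line 1 = y := by simp [line]
  have f0 : f 0 ≠ 0 := by simpa only [f, l0] using hx₀
  -- The zeros of the analytic function f ≢ 0 are discrete, hence countable, and the complement of a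
  -- countable set in ℂ is connected.
  have hconn : IsPreconnected (f ⁻¹' {0})ᶜ := by
    have hcod := mem_codiscrete'.1 (hf.preimage_zero_mem_codiscrete f0)
    have hdisc : IsDiscrete (f ⁻¹' {0}) := by
      simpa only [Set.preimage_compl, compl_compl] using hcod.2
    have hcount : (f ⁻¹' {0}).Countable :=
      (HereditarilyLindelofSpace.isLindelof _).countable_of_isDiscrete hdisc
    exact (hcount.isPathConnected_compl_of_one_lt_rank
      (by simp)).isConnected.isPreconnected
  have hnhds (z : ℂ) (hz : f z ≠ 0) (hz' : line z ∈ Set.range inv) :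
      z ∈ interior (line ⁻¹' Set.range inv) := by
    obtain ⟨x, hx⟩ := hz'
    have hr := range_inv_mem_nhds (x := x) (by rw [hx]; exact hz)
    rw [hx] at hr
    exact mem_interior_iff_mem_nhds.2 ((hline z).continuousAt hr)
  have hcont : Continuous line := continuous_iff_continuousAt.2 fun z => (hline z).continuousAt
  -- The points mapped into the range form a closed set, and those with f ≠ 0 are interior to it.
  have hsub : (f ⁻¹' {0})ᶜ ⊆ interior (line ⁻¹' Set.range inv) :=
    hconn.subset_of_closure_inter_subset isOpen_interior
      ⟨0, f0, hnhds 0 f0 ⟨x₀, l0.symm⟩⟩ fun z hz => hnhds z hz.2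
        (closure_minimal interior_subset (isClosed_range_inv.preimage hcont) hz.1)
  obtain ⟨x, hx⟩ := interior_subset
    (hsub (show (1 : ℂ) ∈ (f ⁻¹' {0})ᶜ by simpa only [Set.mem_compl_iff, Set.mem_preimage, Set.mem_singleton_iff, f, l1] using hy))
  exact ⟨x, hx.trans l1⟩

/-! ### Calculus on the branch

Functions of `t` and `Z` are written as integer polynomials in `t₄`, `Z`, `t₃`, `t₁`, with `t₂`
eliminated by the equation of the branch. -/

/-- `t₂` as a polynomial in `t₄`, `Z`, `t₃`. -/
def branchT2 : Poly := X 1 ^ 2 - C 4 * X 0 ^ 6 + C 12 * X 2 * X 0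

/-- The coordinates `t₄`, `Z`, `t₃`, `t₁`. -/
def branchCoord (Z : (Fin 4 → ℂ) → ℂ) (t : Fin 4 → ℂ) : Fin 4 → ℂ := ![t 3, Z t, t 2, t 0]

/-- `Z⁻¹ ∂p/∂Z` for polynomials without linear term in `Z`. -/
def derivDivZ (p : Poly) : Poly :=
  listMap (listMap (List.rec [] fun _ l _ => l)) (D 1 p)

/-- The polynomial `p` has no linear term in `Z`. -/
def NoLinearTerm (p : Poly) : Prop := isZero (X 1 * derivDivZ p - D 1 p) = true

instance (p : Poly) : Decidable (NoLinearTerm p) := inferInstanceAs (Decidable (_ = _))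

/-- Twice the partial derivatives with respect to `t₁`, `t₂`, `t₃`, `t₄` along the branch. -/
def branchDeriv (i : Fin 4) (p : Poly) : Poly :=
  match i with
  | 0 => C 2 * D 3 p
  | 1 => derivDivZ p
  | 2 => C 2 * D 2 p + C (-12) * X 0 * derivDivZ p
  | 3 => C 2 * D 0 p + (C 24 * X 0 ^ 5 - C 12 * X 2) * derivDivZ p

/-- `131670` times the prepotential. -/
def prepotentialIntPoly : Poly :=
  C 131670 * X 3 * branchT2 * X 2 + C 65835 * X 3 ^ 2 * X 0 + C 664488 * X 0 ^ 21 + C 1685376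
    * X 2 * X 0 ^ 16 + C 5649840 * X 2 ^ 2 * X 0 ^ 11 + C 702240 * X 2 ^ 3 * X 0 ^ 6 + C 3686760
    * X 2 ^ 4 * X 0 + C (-140448) * branchT2 * X 0 ^ 15 + C 1053360 * branchT2 * X 2 * X 0 ^ 10
    + C 4213440 * branchT2 * X 2 ^ 2 * X 0 ^ 5 + C (-351120) * branchT2 * X 2 ^ 3 + C 138985 *
    branchT2 ^ 2 * X 0 ^ 9 + C (-131670) * branchT2 ^ 2 * X 2 * X 0 ^ 4 + C 21945 * branchT2 ^ 3
    * X 0 ^ 3 + C 1254 * X 1 ^ 7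

/-- The functions `15 y₁`, `2 y₂`, `2 y₃`, `y₄` on the branch. -/
def relPoly : Fin 4 → Poly
  | 0 => C (5 * 2 ^ 30 * 5 ^ 9) * (C 27 * branchT2 ^ 2 * X 1 + C (-1800) * X 3 * X 2 + C (-6800) * X
      2 ^ 3 + C (-648) * branchT2 * X 2 * X 0 * X 1 + C 3888 * X 2 ^ 2 * X 0 ^ 2 * X 1 + C 12600 *
      branchT2 * X 2 * X 0 ^ 4 + C 6120 * X 3 * X 0 ^ 5 + C 190320 * X 2 ^ 2 * X 0 ^ 5 + C 216 *
      branchT2 * X 0 ^ 6 * X 1 + C (-2592) * X 2 * X 0 ^ 7 * X 1 + C (-42840) * branchT2 * X 0 ^ 9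
      + C (-953520) * X 2 * X 0 ^ 10 + C 432 * X 0 ^ 12 * X 1 + C 1309136 * X 0 ^ 15)
  | 1 => C (2 ^ 21 * 5 ^ 7) * (C 3 * X 3 + C 38 * X 2 ^ 2 + C (-21) * branchT2 * X 0 ^ 4 + C (-460) *
      X 2 * X 0 ^ 5 + C 950 * X 0 ^ 10)
  | 2 => C (2 ^ 12 * 5 ^ 4) * (C 3 * branchT2 + C 44 * X 2 * X 0 + C (-260) * X 0 ^ 6)
  | 3 => C 40 * X 0

/-- The Euler degrees, multiplied by `10`. -/
def degreesInt : Fin 4 → ℤ := ![10, 6, 5, 1]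

/-- The coordinates `t₁`, `t₂`, `t₃`, `t₄`. -/
def tPoly : Fin 4 → Poly := ![X 3, branchT2, X 2, X 0]

/-- The intersection form, multiplied by `80 * 131670`. -/
def formPoly (i j : Fin 4) : Poly := sum4 fun l =>
  C (degreesInt l) * tPoly l
    * branchDeriv i.rev (branchDeriv j.rev (branchDeriv l prepotentialIntPoly))

/-- Along a branch each derivative lowers the odd power of Z by two: Z⁷, Z⁵, Z³, Z. Division by Z is
thus possible in all three differentiations that form c_{ijk}. -/
theorem noLinearTerm_prepotential : NoLinearTerm prepotentialIntPoly := by decide +kernel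

theorem noLinearTerm_first (l : Fin 4) :
    NoLinearTerm (branchDeriv l prepotentialIntPoly) := by
  revert l; decide +kernel

theorem noLinearTerm_second (j l : Fin 4) :
    NoLinearTerm (branchDeriv j (branchDeriv l prepotentialIntPoly)) := by
  revert j l; decide +kernel

/-- The terms of y₁ containing Z combine to 27 Z⁵ by the equation of the branch. -/
theorem noLinearTerm_relPoly (a : Fin 4) : NoLinearTerm (relPoly a) := by
  revert a; decide +kernel

/-- The metric is antidiagonal; 1053360 = 2³ · 131670 comes from three doubled derivatives and the
scale of the prepotential. -/
theorem isZero_eta (i j : Fin 4) :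
    isZero (branchDeriv i (branchDeriv j (branchDeriv 0 prepotentialIntPoly))
      - C (if i.rev = j then 1053360 else 0)) = true := by
  revert i j; decide +kernel

theorem isZero_form_comm (i j : Fin 4) : isZero (formPoly i j - formPoly j i) = true := by
  revert i j; decide +kernel

/-- This is g^{4k} = E^k: raising an index to 4 inserts the unit field ∂₁ into c, which leaves the
metric. -/
theorem isZero_form_last (k : Fin 4) :
    isZero (formPoly 3 k - C (1053360 * degreesInt k) * tPoly k) = true := by
  revert k; decide +kernel

/-- The Frobenius half of the computation. Here 42134400 = 4 · 10533600: two doubled derivatives and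
the scale of `formPoly`; the 3 matches the one in `gramPoly`. -/
theorem isZero_form_gram (a b : Fin 4) (h : a ≤ b) :
    isZero (C 3 * (sum4 fun k => branchDeriv k (relPoly a) *
      sum4 fun l => formPoly k l * branchDeriv l (relPoly b))
      - C 42134400 * gramPoly relPoly a b) = true := by
  revert a b; decide +kernel

/-! ### Derivatives, metric and intersection form along a branch. -/

section Branch

variable {U : Set (Fin 4 → ℂ)} {Z : (Fin 4 → ℂ) → ℂ} {t : Fin 4 → ℂ}

theorem IsBranch.eval_branchT2 (hZ : IsBranch U Z) (ht : t ∈ U) :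
    eval (branchCoord Z t) branchT2 = t 1 := by
  have h := hZ.equation t ht
  simp [branchT2, branchCoord, eval_sub, eval_add, eval_mul, eval_pow, eval_C, eval_X]
  linear_combination h

/-- The differentiated equation of the branch, kept multiplied by Z so that it also holds where Z =
0. -/
theorem IsBranch.mul_pderiv (hU : IsOpen U) (hZ : IsBranch U Z) (ht : t ∈ U) (i : Fin 4) :
    2 * (Z t * pderiv i Z t) = ![0, 1, -12 * t 3, 24 * t 3 ^ 5 - 12 * t 2] i := by
  have hd : DifferentiableAt ℂ Z t := (hZ.analytic t ht).differentiableAt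
  have h : pderiv i (fun s => Z s ^ 2 - 4 * s 3 * (s 3 ^ 5 - 3 * s 2) - s 1) t = 0 := by
    rw [← pderiv_const (t := t) i 0]
    exact pderiv_congr i (eventually_of_mem (hU.mem_nhds ht) hZ.equation)
  simp (disch := fun_prop) only [pderiv_sub, pderiv_mul, pderiv_pow, pderiv_const,
    pderiv_apply] at h
  fin_cases i <;> simp only [Fin.zero_eta, Fin.mk_one, Fin.reduceFinMk, Matrix.cons_val,
    Fin.reduceEq, if_true, if_false] at h ⊢ <;> push_cast at h <;> linear_combination h

theorem eval_derivDivZ {p : Poly} (hp : NoLinearTerm p) (u : Fin 4 → ℂ) :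
    eval u (D 1 p) = u 1 * eval u (derivDivZ p) := by
  rw [← eval_eq_of_isZero_sub u hp, eval_mul, eval_X]

theorem differentiableAt_branchCoord (hZ : DifferentiableAt ℂ Z t) (k : Fin 4) :
    DifferentiableAt ℂ (fun s => branchCoord Z s k) t := by
  fin_cases k <;> simp [branchCoord] <;> fun_prop

/-- The chain-rule term (∂p/∂Z) ∂ᵢZ equals (Z⁻¹ ∂p/∂Z)(Z ∂ᵢZ), where both factors are polynomials;
nothing is divided by Z. -/
theorem IsBranch.pderiv_eval (hU : IsOpen U) (hZ : IsBranch U Z) (ht : t ∈ U) {p : Poly}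
    (hp : NoLinearTerm p) (i : Fin 4) :
    pderiv i (fun s => eval (branchCoord Z s) p) t
      = eval (branchCoord Z t) (branchDeriv i p) / 2 := by
  have hd : DifferentiableAt ℂ Z t := (hZ.analytic t ht).differentiableAt
  have hq := hZ.mul_pderiv hU ht i
  have h1 := eval_derivDivZ hp (branchCoord Z t)
  rw [AlgFrobenius.pderiv_eval i (differentiableAt_branchCoord hd), Fin.sum_univ_four, h1]
  simp only [branchCoord, Matrix.cons_val, pderiv_apply] at hq h1 ⊢
  fin_cases i <;>
    simp only [Fin.zero_eta, Fin.mk_one, Fin.reduceFinMk, Fin.reduceEq, if_true, if_false,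
      branchDeriv, eval_add, eval_sub, eval_mul, eval_pow, eval_C, eval_X, Matrix.cons_val]
      at hq ⊢ <;>
    push_cast <;>
    linear_combination (1 / 2) * eval ![t 3, Z t, t 2, t 0] (derivDivZ p) * hq

theorem IsBranch.prepotential_eq (hZ : IsBranch U Z) (ht : t ∈ U) :
    prepotential Z t = 131670⁻¹ * eval (branchCoord Z t) prepotentialIntPoly := by
  have h2 := hZ.eval_branchT2 ht
  simp only [prepotentialIntPoly, eval_add, eval_mul, eval_pow, eval_C, eval_X, h2]
  simp only [prepotential, prepotentialPoly, branchCoord, Matrix.cons_val]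
  push_cast
  ring

theorem IsBranch.cLower_eq (hU : IsOpen U) (hZ : IsBranch U Z) (ht : t ∈ U) (a b l : Fin 4) :
    cLower (prepotential Z) a b l t = 1053360⁻¹ * eval (branchCoord Z t)
      (branchDeriv a (branchDeriv b (branchDeriv l prepotentialIntPoly))) := by
  have step {f : (Fin 4 → ℂ) → ℂ} {c : ℂ} {p : Poly} (hp : NoLinearTerm p)
      (hf : ∀ s ∈ U, f s = c * eval (branchCoord Z s) p) (i : Fin 4) :
      ∀ s ∈ U, pderiv i f s = c / 2 * eval (branchCoord Z s) (branchDeriv i p) := by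
    intro s hs
    have hd : DifferentiableAt ℂ Z s := (hZ.analytic s hs).differentiableAt
    have he : DifferentiableAt ℂ (fun s => eval (branchCoord Z s) p) s :=
      DifferentiableAt.comp (g := fun u => eval u p) s (analyticAt_eval _ p).differentiableAt
        (differentiableAt_pi.2 (differentiableAt_branchCoord hd))
    rw [pderiv_congr i (eventually_of_mem (hU.mem_nhds hs) hf),
      pderiv_mul i (differentiableAt_const c) he, pderiv_const, hZ.pderiv_eval hU hs hp]
    ring
  have h := step (noLinearTerm_second b l) (step (noLinearTerm_first l)
    (step noLinearTerm_prepotential (fun s hs => hZ.prepotential_eq hs) l) b) a t ht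
  rw [cLower, h]
  norm_num

theorem IsBranch.eta_eq (hU : IsOpen U) (hZ : IsBranch U Z) (ht : t ∈ U) :
    eta (prepotential Z) t = Matrix.of fun i j : Fin 4 => if i.rev = j then 1 else 0 := by
  ext i j
  rw [eta, Matrix.of_apply, hZ.cLower_eq hU ht, eval_eq_of_isZero_sub _ (isZero_eta i j), eval_C]
  rw [Matrix.of_apply]
  split_ifs <;> norm_num

theorem IsBranch.eta_inv (hU : IsOpen U) (hZ : IsBranch U Z) (ht : t ∈ U) :
    (eta (prepotential Z) t)⁻¹ = Matrix.of fun i j : Fin 4 => if i.rev = j then 1 else 0 := by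
  rw [hZ.eta_eq hU ht]
  refine Matrix.inv_eq_right_inv ?_
  ext i j
  fin_cases i <;> fin_cases j <;> simp [Matrix.mul_apply, Fin.rev_eq_iff]

theorem IsBranch.eval_tPoly (hZ : IsBranch U Z) (ht : t ∈ U) (l : Fin 4) :
    eval (branchCoord Z t) (tPoly l) = t l := by
  fin_cases l
  · exact eval_X _ 3
  · exact hZ.eval_branchT2 ht
  · exact eval_X _ 2
  · exact eval_X _ 0

theorem degrees_eq (l : Fin 4) : degrees l = (degreesInt l : ℂ) / 10 := by
  fin_cases l <;> simp [degrees, degreesInt] <;> norm_num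

theorem IsBranch.intersectionForm_eq (hU : IsOpen U) (hZ : IsBranch U Z) (ht : t ∈ U)
    (i j : Fin 4) :
    intersectionForm (prepotential Z) degrees t i j
      = 10533600⁻¹ * eval (branchCoord Z t) (formPoly i j) := by
  -- The inverse metric is the reversal permutation matrix, so raising an index reverses it.
  have hc (l : Fin 4) : cUpper (prepotential Z) i j l t
      = cLower (prepotential Z) i.rev j.rev l t := by
    simp only [cUpper, cMixed, hZ.eta_inv hU ht, Matrix.of_apply, ite_mul, one_mul, zero_mul,
      Finset.sum_ite_eq, Finset.mem_univ, if_true]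
  rw [intersectionForm, Matrix.of_apply]
  simp only [hc, hZ.cLower_eq hU ht, degrees_eq, formPoly, sum4, eval_add, eval_mul, eval_C,
    hZ.eval_tPoly ht, Fin.sum_univ_four]
  ring

theorem IsBranch.intersectionForm_last (hU : IsOpen U) (hZ : IsBranch U Z) (ht : t ∈ U)
    (k : Fin 4) : intersectionForm (prepotential Z) degrees t 3 k = degrees k * t k := by
  rw [hZ.intersectionForm_eq hU ht, eval_eq_of_isZero_sub _ (isZero_form_last k), eval_mul, eval_C,
    hZ.eval_tPoly ht, degrees_eq]
  push_cast
  ring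

/-- The right-hand sides of the relations. -/
def rel (Z : (Fin 4 → ℂ) → ℂ) (t : Fin 4 → ℂ) : Fin 4 → ℂ :=
  ![y1OfT (t 0) (t 1) (t 2) (t 3) (Z t), y2OfT (t 0) (t 1) (t 2) (t 3), y3OfT (t 1) (t 2) (t 3),
    40 * t 3]

theorem relations_iff {x : Fin 4 → ℂ} : Relations x t (Z t) ↔ inv x = rel Z t := by
  simp [Relations, inv, rel, funext_iff, Fin.forall_fin_succ]

theorem IsBranch.eval_relPoly (hZ : IsBranch U Z) (ht : t ∈ U) (a : Fin 4) :
    eval (branchCoord Z t) (relPoly a) = invScale a * rel Z t a := by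
  have h2 := hZ.eval_branchT2 ht
  fin_cases a <;>
  · simp only [relPoly, eval_add, eval_mul, eval_pow, eval_C, eval_X, h2]
    simp only [invScale, rel, y1OfT, y2OfT, y3OfT, branchCoord, Matrix.cons_val]
    push_cast
    ring

theorem IsBranch.analyticAt_rel (hU : IsOpen U) (hZ : IsBranch U Z) (ht : t ∈ U) :
    AnalyticAt ℂ (rel Z) t := by
  refine AnalyticAt.pi fun a => ?_
  have hc : AnalyticAt ℂ (branchCoord Z) t := by
    have hp (i : Fin 4) : AnalyticAt ℂ (fun s : Fin 4 → ℂ => s i) t :=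
      (ContinuousLinearMap.proj (R := ℂ) (φ := fun _ : Fin 4 => ℂ) i).analyticAt t
    refine AnalyticAt.pi fun k => ?_
    fin_cases k
    · exact hp 3
    · exact hZ.analytic t ht
    · exact hp 2
    · exact hp 0
  have h : AnalyticAt ℂ
      (fun s => (invScale a : ℂ)⁻¹ * eval (branchCoord Z s) (relPoly a)) t :=
    analyticAt_const.fun_mul
      (AnalyticAt.comp (g := fun u => eval u (relPoly a)) (analyticAt_eval _ _) hc)
  refine h.congr (eventually_of_mem (hU.mem_nhds ht) fun s hs => ?_)
  change (invScale a : ℂ)⁻¹ * eval (branchCoord Z s) (relPoly a) = rel Z s a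
  rw [hZ.eval_relPoly hs, inv_mul_cancel_left₀ (invScale_ne_zero a)]

theorem IsBranch.pderiv_rel (hU : IsOpen U) (hZ : IsBranch U Z) (ht : t ∈ U) (i a : Fin 4) :
    invScale a * pderiv i (fun s => rel Z s a) t
      = eval (branchCoord Z t) (branchDeriv i (relPoly a)) / 2 := by
  have hd : DifferentiableAt ℂ (fun s => rel Z s a) t :=
    differentiableAt_pi.1 (hZ.analyticAt_rel hU ht).differentiableAt a
  rw [← hZ.pderiv_eval hU ht (noLinearTerm_relPoly a), pderiv_congr i
    (eventually_of_mem (hU.mem_nhds ht) fun s hs => hZ.eval_relPoly hs a),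
    pderiv_mul i (differentiableAt_const _) hd, pderiv_const]
  ring

theorem IsBranch.intersectionForm_comm (hU : IsOpen U) (hZ : IsBranch U Z) (ht : t ∈ U)
    (i j : Fin 4) : intersectionForm (prepotential Z) degrees t i j
      = intersectionForm (prepotential Z) degrees t j i := by
  rw [hZ.intersectionForm_eq hU ht, hZ.intersectionForm_eq hU ht,
    eval_eq_of_isZero_sub _ (isZero_form_comm i j)]

theorem IsBranch.sum_pderiv_rel_of_le (hU : IsOpen U) (hZ : IsBranch U Z) (ht : t ∈ U)
    (a b : Fin 4) (h : a ≤ b) :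
    ∑ k, ∑ l, pderiv k (fun s => rel Z s a) t * intersectionForm (prepotential Z) degrees t k l
      * pderiv l (fun s => rel Z s b) t = gram (rel Z t) a b := by
  have key := eval_eq_of_isZero_sub (branchCoord Z t) (isZero_form_gram a b h)
  simp only [sum4, eval_add, eval_mul, eval_C, eval_gramPoly fun a => hZ.eval_relPoly ht a] at key
  have ha := invScale_ne_zero a
  have hb := invScale_ne_zero b
  have hf (k l : Fin 4) : eval (branchCoord Z t) (formPoly k l)
      = 10533600 * intersectionForm (prepotential Z) degrees t k l := by
    rw [hZ.intersectionForm_eq hU ht]; ring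
  have hr (k a : Fin 4) : eval (branchCoord Z t) (branchDeriv k (relPoly a))
      = 2 * (invScale a * pderiv k (fun s => rel Z s a) t) := by
    rw [hZ.pderiv_rel hU ht]; ring
  simp only [hf, hr] at key
  push_cast at key
  refine mul_left_cancel₀ (mul_ne_zero ha hb) ?_
  simp only [Fin.sum_univ_four]
  -- The constant is 3 · 2² · 10533600.
  linear_combination (1 / 126403200) * key

theorem IsBranch.jac_rel (hU : IsOpen U) (hZ : IsBranch U Z) (ht : t ∈ U) :
    jac (rel Z) t * intersectionForm (prepotential Z) degrees t * (jac (rel Z) t).transpose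
      = gram (rel Z t) := by
  ext a b
  have h : (jac (rel Z) t * intersectionForm (prepotential Z) degrees t
      * (jac (rel Z) t).transpose) a b = ∑ k, ∑ l, pderiv k (fun s => rel Z s a) t
        * intersectionForm (prepotential Z) degrees t k l * pderiv l (fun s => rel Z s b) t := by
    simp only [Matrix.mul_apply, Matrix.transpose_apply, jac, Matrix.of_apply, Finset.sum_mul]
    exact Finset.sum_comm
  rw [h]
  rcases le_total a b with hab | hab
  · exact hZ.sum_pderiv_rel_of_le hU ht a b hab
  · rw [gram_comm, ← hZ.sum_pderiv_rel_of_le hU ht b a hab, Finset.sum_comm]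
    refine Finset.sum_congr rfl fun k _ => Finset.sum_congr rfl fun l _ => ?_
    rw [hZ.intersectionForm_comm hU ht l k]
    ring

end Branch

/-! ### Points with nondegenerate Gram matrix -/

/-- The right-hand sides of the relations as functions of `t` and `Z`. -/
def relOf (z : ℂ) (t : Fin 4 → ℂ) : Fin 4 → ℂ :=
  ![y1OfT (t 0) (t 1) (t 2) (t 3) z, y2OfT (t 0) (t 1) (t 2) (t 3), y3OfT (t 1) (t 2) (t 3),
    40 * t 3]

/-- The weights of the right-hand sides of the relations. -/
def relWeight : Fin 4 → ℕ := ![15, 10, 6, 1]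

theorem relOf_weighted (r z : ℂ) (t : Fin 4 → ℂ) (a : Fin 4) :
    relOf (r ^ 3 * z) ![r ^ 10 * t 0, r ^ 6 * t 1, r ^ 5 * t 2, r * t 3] a
      = r ^ relWeight a * relOf z t a := by
  fin_cases a <;> simp [relOf, relWeight, y1OfT, y2OfT, y3OfT] <;> ring

/-- G_ab has weight w_a + w_b - 1, half the degree of a product of two gradients; the -1 is the
extra factor r on the left. -/
theorem det_gram_weighted (r : ℂ) (hr : r ≠ 0) (y : Fin 4 → ℂ) (hy : (gram y).det = 0) :
    (gram fun a => r ^ relWeight a * y a).det = 0 := by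
  have h : r • gram (fun a => r ^ relWeight a * y a)
      = Matrix.diagonal (fun a => r ^ relWeight a) * gram y
        * Matrix.diagonal (fun a => r ^ relWeight a) := by
    ext a b
    rw [Matrix.mul_diagonal, Matrix.diagonal_mul, Matrix.smul_apply, smul_eq_mul]
    fin_cases a <;> fin_cases b <;> simp [gram, relWeight] <;> ring
  have hdet := congrArg Matrix.det h
  rw [Matrix.det_smul, Matrix.det_mul, Matrix.det_mul, hy, mul_zero, zero_mul] at hdet
  exact (mul_eq_zero.1 hdet).resolve_left (pow_ne_zero _ hr)

theorem contDiff_relOf : ContDiff ℂ ω fun p : ℂ × (Fin 4 → ℂ) => relOf p.1 p.2 := by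
  rw [contDiff_pi]
  intro a
  fin_cases a <;> simp [relOf, y1OfT, y2OfT, y3OfT] <;> fun_prop

theorem contDiff_det_gram : ContDiff ℂ ω fun s => (gram s).det :=
  contDiff_iff_contDiffAt.2 fun s => (analyticAt_det_gram s).contDiffAt

theorem contDiff_det_gram_relOf :
    ContDiff ℂ ω fun p : ℂ × (Fin 4 → ℂ) => (gram (relOf p.1 p.2)).det :=
  ContDiff.comp (g := fun s => (gram s).det) (f := fun p : ℂ × (Fin 4 → ℂ) => relOf p.1 p.2)
    contDiff_det_gram contDiff_relOf

/-- At y = (0, c, 0, 0) only the entries (1,3) and (2,4) and their mirror images survive, so G is an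
invertible monomial matrix. -/
theorem det_gram_relOf_single_ne_zero : (gram (relOf 0 (Pi.single 0 1))).det ≠ 0 := by
  have h : relOf 0 (Pi.single 0 1) = ![0, 3 * (2 ^ 20 * 5 ^ 7), 0, 0] := by
    ext a
    fin_cases a <;> simp [relOf, y1OfT, y2OfT, y3OfT, mul_comm]
  rw [h]
  simp [gram, Matrix.det_succ_row_zero, Fin.sum_univ_succ, Fin.succAbove]

theorem exists_det_gram_relOf_ne_zero (z : ℂ) (t : Fin 4 → ℂ) :
    ∃ T, (gram (relOf z (Function.update t 0 T))).det ≠ 0 := by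
  by_contra! h
  -- The rescaling by r of the point with t₁ = r⁻¹⁰: t₁ stays at 1 while every other coordinate and
  -- Z tend to 0 with r. Vanishing for r ≠ 0 would pass to the limit.
  let p (r : ℂ) : ℂ × (Fin 4 → ℂ) := (r ^ 3 * z, ![1, r ^ 6 * t 1, r ^ 5 * t 2, r * t 3])
  have hp : Continuous p := by
    refine Continuous.prodMk (by fun_prop) (continuous_pi fun i => ?_)
    fin_cases i <;> simp <;> fun_prop
  have hp0 : p 0 = (0, Pi.single 0 1) := by
    refine Prod.ext (by simp [p]) (funext fun i => ?_)
    fin_cases i <;> simp [p]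
  have hzero (r : ℂ) (hr : r ≠ 0) : (gram (relOf (p r).1 (p r).2)).det = 0 := by
    have h₁ := relOf_weighted r z (Function.update t 0 (r ^ 10)⁻¹)
    have h₂ := det_gram_weighted r hr _ (h (r ^ 10)⁻¹)
    rw [← funext h₁] at h₂
    have h₃ : (![r ^ 10 * Function.update t 0 (r ^ 10)⁻¹ 0, r ^ 6 * Function.update t 0 (r ^ 10)⁻¹ 1,
        r ^ 5 * Function.update t 0 (r ^ 10)⁻¹ 2, r * Function.update t 0 (r ^ 10)⁻¹ 3]
          : Fin 4 → ℂ) = (p r).2 := by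
      ext i
      fin_cases i <;> simp [p, hr]
    rwa [h₃] at h₂
  obtain ⟨G, hG⟩ : ∃ G : ℂ × (Fin 4 → ℂ) → ℂ, ∀ q, G q = (gram (relOf q.1 q.2)).det :=
    ⟨_, fun _ => rfl⟩
  have hcont : Continuous G := by
    rw [funext hG]
    exact contDiff_det_gram_relOf.continuous
  have hev : (fun r => G (p r)) =ᶠ[𝓝[≠] 0] fun _ => 0 :=
    eventually_nhdsWithin_of_forall fun r hr => (hG _).trans (hzero r hr)
  refine det_gram_relOf_single_ne_zero (((hG _).symm.trans (congrArg G hp0.symm)).trans ?_)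
  exact tendsto_nhds_unique ((hcont.comp hp).continuousAt.mono_left nhdsWithin_le_nhds)
    (tendsto_const_nhds.congr' hev.symm)

theorem eventually_det_gram_relOf_ne_zero (z : ℂ) (t : Fin 4 → ℂ) (T₀ : ℂ) :
    ∀ᶠ T in 𝓝[≠] T₀, (gram (relOf z (Function.update t 0 T))).det ≠ 0 := by
  have hupd : ContDiff ℂ ω fun T : ℂ => Function.update t 0 T := by
    rw [contDiff_pi]
    intro i
    by_cases hi : i = 0
    · subst hi; simp only [Function.update_self]; exact contDiff_id
    · simpa [hi] using contDiff_const
  have hf := contDiff_det_gram_relOf.comp ((contDiff_const (c := z)).prodMk hupd)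
  have ha : AnalyticOnNhd ℂ (fun T => (gram (relOf z (Function.update t 0 T))).det) Set.univ :=
    fun T _ => hf.contDiffAt.analyticAt
  refine (ha T₀ trivial).eventually_eq_zero_or_eventually_ne_zero.resolve_left fun h => ?_
  obtain ⟨T, hT⟩ := exists_det_gram_relOf_ne_zero z t
  exact hT (ha.eqOn_zero_of_preconnected_of_eventuallyEq_zero isPreconnected_univ trivial h
    (Set.mem_univ T))

theorem IsBranch.exists_det_gram_rel_ne_zero {U V : Set (Fin 4 → ℂ)} {Z : (Fin 4 → ℂ) → ℂ}
    (hZ : IsBranch U Z) (hV : IsOpen V) (hne : V.Nonempty) (hVU : V ⊆ U) :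
    ∃ t ∈ V, (gram (rel Z t)).det ≠ 0 := by
  obtain ⟨t, ht⟩ := hne
  have hcont : ContinuousAt (fun T : ℂ => Function.update t 0 T) (t 0) :=
    (continuous_const.update 0 continuous_id).continuousAt
  have hmem : ∀ᶠ T in 𝓝[≠] (t 0), Function.update t 0 T ∈ V :=
    nhdsWithin_le_nhds (hcont (by simpa using hV.mem_nhds ht))
  obtain ⟨T, hT, h₁, h₂⟩ := (hmem.and ((eventually_det_gram_relOf_ne_zero (Z t) t (t 0)).and
    (eventually_det_gram_relOf_ne_zero (-Z t) t (t 0)))).exists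
  refine ⟨_, hT, ?_⟩
  -- The equation of the branch does not involve t₁, so moving t₁ alone can change Z at most by a
  -- sign. This is why T was chosen to suit both signs.
  have hsq : Z (Function.update t 0 T) ^ 2 = Z t ^ 2 := by
    have e₁ := hZ.equation _ (hVU hT)
    have e₂ := hZ.equation _ (hVU ht)
    simp only [Function.update_of_ne (show (3 : Fin 4) ≠ 0 by decide),
      Function.update_of_ne (show (2 : Fin 4) ≠ 0 by decide),
      Function.update_of_ne (show (1 : Fin 4) ≠ 0 by decide)] at e₁
    linear_combination e₁ - e₂
  change (gram (relOf (Z (Function.update t 0 T)) _)).det ≠ 0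
  rcases sq_eq_sq_iff_eq_or_eq_neg.1 hsq with h | h
  · rwa [h]
  · rwa [h]

/-! ### Existence of flat coordinates -/

theorem jac_comp {f g : (Fin 4 → ℂ) → Fin 4 → ℂ} {t : Fin 4 → ℂ}
    (hf : DifferentiableAt ℂ f (g t)) (hg : DifferentiableAt ℂ g t) :
    jac (fun s => f (g s)) t = jac f (g t) * jac g t := by
  ext a i
  simp only [Matrix.mul_apply, jac, Matrix.of_apply]
  exact pderiv_comp (F := fun y => f y a) i (differentiableAt_pi.1 hf a) hg

theorem jac_congr {f g : (Fin 4 → ℂ) → Fin 4 → ℂ} {t : Fin 4 → ℂ} (h : f =ᶠ[𝓝 t] g) :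
    jac f t = jac g t := by
  ext a i
  exact pderiv_congr i (h.mono fun s hs => congrFun hs a)

theorem orthonormal_iff (F : (Fin 4 → ℂ) → ℂ) (deg : Fin 4 → ℂ) (x : (Fin 4 → ℂ) → Fin 4 → ℂ)
    (t : Fin 4 → ℂ) :
    (∀ i j, ∑ k, ∑ l, intersectionForm F deg t k l * pderiv k (fun s => x s i) t
        * pderiv l (fun s => x s j) t = if i = j then 1 else 0)
      ↔ jac x t * intersectionForm F deg t * (jac x t).transpose = 1 := by
  rw [← Matrix.ext_iff]
  refine forall_congr' fun i => forall_congr' fun j => ?_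
  rw [Matrix.one_apply]
  have h : (jac x t * intersectionForm F deg t * (jac x t).transpose) i j
      = ∑ k, ∑ l, intersectionForm F deg t k l * pderiv k (fun s => x s i) t
        * pderiv l (fun s => x s j) t := by
    simp only [Matrix.mul_apply, Matrix.transpose_apply, jac, Matrix.of_apply, Finset.sum_mul]
    rw [Finset.sum_comm]
    refine Finset.sum_congr rfl fun k _ => Finset.sum_congr rfl fun l _ => ?_
    ring
  rw [h]

theorem jac_inv_last (x : Fin 4 → ℂ) (i : Fin 4) : jac inv x 3 i = 2 * x i := by
  have h : (fun s => inv s 3) = fun s => s 0 ^ 2 + (s 1 ^ 2 + s 2 ^ 2 + s 3 ^ 2) := rfl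
  rw [jac, Matrix.of_apply, h]
  simp (disch := fun_prop) only [pderiv_add, pderiv_pow, pderiv_apply]
  fin_cases i <;> simp

theorem jac_rel_last (Z : (Fin 4 → ℂ) → ℂ) (t : Fin 4 → ℂ) (i : Fin 4) :
    jac (rel Z) t 3 i = if i = 3 then 40 else 0 := by
  have h : (fun s => rel Z s 3) = fun s => 40 * s 3 := rfl
  rw [jac, Matrix.of_apply, h]
  simp (disch := fun_prop) only [pderiv_mul, pderiv_const, pderiv_apply]
  fin_cases i <;> simp

/-- With J_r = J_inv J_x, the identity J_r g J_rᵀ = G(r) = J_inv J_invᵀ yields orthonormality after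
J_inv is cancelled on both sides. -/
theorem isFlatCoordinates_of_inv_eq_rel {U W : Set (Fin 4 → ℂ)} {Z : (Fin 4 → ℂ) → ℂ}
    (hU : IsOpen U) (hZ : IsBranch U Z) (hW : IsOpen W) (hWU : W ⊆ U)
    {x : (Fin 4 → ℂ) → Fin 4 → ℂ} (hx : AnalyticOnNhd ℂ x W)
    (hrel : ∀ t ∈ W, inv (x t) = rel Z t) (hdet : ∀ t ∈ W, (gram (rel Z t)).det ≠ 0) :
    IsFlatCoordinates (prepotential Z) degrees charge W x := by
  have hchain (t) (ht : t ∈ W) : jac inv (x t) * jac x t = jac (rel Z) t := by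
    rw [← jac_comp (analyticAt_inv _).differentiableAt (hx t ht).differentiableAt]
    exact jac_congr (eventually_of_mem (hW.mem_nhds ht) hrel)
  have hunit (t) (ht : t ∈ W) : IsUnit (jac inv (x t)) := by
    rw [Matrix.isUnit_iff_isUnit_det, isUnit_iff_ne_zero]
    exact det_jac_inv_ne_zero (by rw [hrel t ht]; exact hdet t ht)
  have horth (t) (ht : t ∈ W) :
      jac x t * intersectionForm (prepotential Z) degrees t * (jac x t).transpose = 1 := by
    have h := hZ.jac_rel hU (hWU ht)
    rw [← hrel t ht, ← jac_inv_mul_transpose, ← hchain t ht, Matrix.transpose_mul] at h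
    have hunit' : IsUnit (jac inv (x t)).transpose :=
      (Matrix.isUnit_transpose (A := jac inv (x t))).2 (hunit t ht)
    refine (hunit t ht).mul_left_cancel (hunit'.mul_right_cancel ?_)
    rw [mul_one, ← h]
    simp only [Matrix.mul_assoc]
  refine ⟨hx, fun t ht => (orthonormal_iff _ _ x t).2 (horth t ht), fun t ht i => ?_⟩
  -- The last row of this identity is the Euler condition: it reads 40 E(xᵢ) = 2 xᵢ, and (1 - d)/2 =
  -- 1/20.
  have h : jac (rel Z) t * intersectionForm (prepotential Z) degrees t * (jac x t).transpose
      = jac inv (x t) := by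
    rw [← hchain t ht, Matrix.mul_assoc, Matrix.mul_assoc, ← Matrix.mul_assoc (jac x t),
      horth t ht, mul_one]
  have h3 := congrFun (congrFun h 3) i
  rw [jac_inv_last] at h3
  simp only [Matrix.mul_apply, jac_rel_last, ite_mul, zero_mul, Finset.sum_ite_eq',
    Finset.mem_univ, if_true, hZ.intersectionForm_last hU (hWU ht), Matrix.transpose_apply] at h3
  simp only [jac, Matrix.of_apply] at h3
  simp only [Fin.sum_univ_four, charge] at h3 ⊢
  linear_combination (1 / 40) * h3

theorem exists_analytic_localInverse {f : (Fin 4 → ℂ) → Fin 4 → ℂ} {x₀ : Fin 4 → ℂ}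
    (hf : AnalyticAt ℂ f x₀) (hdet : (jac f x₀).det ≠ 0) :
    ∃ g : (Fin 4 → ℂ) → Fin 4 → ℂ, AnalyticAt ℂ g (f x₀) ∧ (∀ᶠ y in 𝓝 (f x₀), f (g y) = y) ∧
      ∀ᶠ x in 𝓝 x₀, g (f x) = x := by
  have hdet' : (fderiv ℂ f x₀).det ≠ 0 := by rwa [det_fderiv hf.differentiableAt]
  have hd := hf.differentiableAt.hasFDerivAt
  rw [← ContinuousLinearMap.coe_toContinuousLinearEquivOfDetNeZero _ hdet'] at hd
  have hc : ContDiffAt ℂ ω f x₀ := hf.contDiffAt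
  exact ⟨hc.localInverse hd (by simp), (hc.to_localInverse hd (by simp)).analyticAt,
    (hc.hasStrictFDerivAt' hd (by simp)).eventually_right_inverse,
    (hc.hasStrictFDerivAt' hd (by simp)).eventually_left_inverse⟩

theorem exists_isFlatCoordinates {U V : Set (Fin 4 → ℂ)} {Z : (Fin 4 → ℂ) → ℂ}
    (hU : IsOpen U) (hZ : IsBranch U Z) (hV : IsOpen V) (hne : V.Nonempty) (hVU : V ⊆ U) :
    ∃ W : Set (Fin 4 → ℂ), IsOpen W ∧ W.Nonempty ∧ W ⊆ V ∧ ∃ x : (Fin 4 → ℂ) → Fin 4 → ℂ,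
      IsFlatCoordinates (prepotential Z) degrees charge W x ∧
        ∀ t ∈ W, Relations (x t) t (Z t) := by
  obtain ⟨t₀, ht₀, hdet⟩ := hZ.exists_det_gram_rel_ne_zero hV hne hVU
  obtain ⟨x₀, hx₀⟩ := exists_inv_eq hdet
  obtain ⟨g, hg, hright, -⟩ := exists_analytic_localInverse (analyticAt_inv x₀)
    (det_jac_inv_ne_zero (by rwa [hx₀]))
  rw [hx₀] at hg hright
  have hra : AnalyticAt ℂ (rel Z) t₀ := hZ.analyticAt_rel hU (hVU ht₀)
  have hdet_ev : ∀ᶠ t in 𝓝 t₀, (gram (rel Z t)).det ≠ 0 :=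
    ((analyticAt_det_gram _).continuousAt.comp hra.continuousAt).eventually_ne hdet
  have hev : ∀ᶠ t in 𝓝 t₀, t ∈ V ∧ AnalyticAt ℂ (fun s => g (rel Z s)) t
      ∧ inv (g (rel Z t)) = rel Z t ∧ (gram (rel Z t)).det ≠ 0 :=
    (show ∀ᶠ t in 𝓝 t₀, t ∈ V from hV.mem_nhds ht₀).and
      ((AnalyticAt.comp (g := g) hg hra).eventually_analyticAt.and
      ((hra.continuousAt.eventually hright).and hdet_ev))
  obtain ⟨W, hWsub, hW, ht₀W⟩ := eventually_nhds_iff.1 hev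
  refine ⟨W, hW, ⟨t₀, ht₀W⟩, fun t ht => (hWsub t ht).1, fun s => g (rel Z s), ?_, fun t ht => ?_⟩
  · exact isFlatCoordinates_of_inv_eq_rel hU hZ hW (fun t ht => hVU (hWsub t ht).1)
      (fun t ht => (hWsub t ht).2.1) (fun t ht => (hWsub t ht).2.2.1)
      (fun t ht => (hWsub t ht).2.2.2)
  · exact relations_iff.2 (hWsub t ht).2.2.1

/-! ### Uniqueness of flat coordinates up to an orthogonal matrix -/

theorem analyticAt_coord {f : (Fin 4 → ℂ) → Fin 4 → ℂ} {t : Fin 4 → ℂ} (hf : AnalyticAt ℂ f t)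
    (a : Fin 4) : AnalyticAt ℂ (fun s => f s a) t :=
  analyticAt_pi_iff.1 hf a

/-- The argument for the vanishing of Christoffel symbols: S(l,i,j) = ∑ₐ ∂ₗ∂ᵢφₐ ∂ⱼφₐ is symmetric in
l, i and, by differentiating the orthogonality relation, antisymmetric in i, j. -/
theorem pderiv_pderiv_eq_zero {B : Set (Fin 4 → ℂ)} (hB : IsOpen B)
    {φ : (Fin 4 → ℂ) → Fin 4 → ℂ} (hφ : AnalyticOnNhd ℂ φ B)
    (horth : ∀ u ∈ B, (jac φ u).transpose * jac φ u = 1) {u : Fin 4 → ℂ} (hu : u ∈ B)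
    (l i a : Fin 4) : pderiv l (pderiv i fun s => φ s a) u = 0 := by
  have han (a : Fin 4) := analyticAt_coord (hφ u hu) a
  have hd (i a : Fin 4) : DifferentiableAt ℂ (pderiv i fun s => φ s a) u :=
    (analyticAt_pderiv i (han a)).differentiableAt
  let S (l i j : Fin 4) : ℂ :=
    ∑ a, pderiv l (pderiv i fun s => φ s a) u * pderiv j (fun s => φ s a) u
  have hcomm (l i j : Fin 4) : S l i j = S i l j :=
    Finset.sum_congr rfl fun a _ => by rw [pderiv_comm l i (han a)]
  have hanti (l i j : Fin 4) : S l i j + S l j i = 0 := by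
    have h : pderiv l (fun s => ∑ a, pderiv i (fun r => φ r a) s * pderiv j (fun r => φ r a) s) u
        = 0 := by
      rw [← pderiv_const (t := u) l ((1 : Matrix (Fin 4) (Fin 4) ℂ) i j)]
      refine pderiv_congr l (eventually_of_mem (hB.mem_nhds hu) fun s hs => ?_)
      simpa only [Matrix.mul_apply, Matrix.transpose_apply, jac, Matrix.of_apply] using
        congrFun (congrFun (horth s hs) i) j
    rw [pderiv_sum l _ fun a _ => (hd i a).fun_mul (hd j a)] at h
    simp only [pderiv_mul l (hd i _) (hd j _)] at h
    rw [← h, ← Finset.sum_add_distrib]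
    exact Finset.sum_congr rfl fun a _ => by ring
  -- Alternating the two symmetries around the three indices gives S = -S.
  have hS (l i j : Fin 4) : S l i j = 0 := by
    linear_combination (1 / 2 : ℂ) * (hanti l i j - hcomm l j i - hanti j l i + hcomm j i l
      + hanti i j l - hcomm i l j)
  have hmul : (jac φ u).transpose.mulVec (fun a => pderiv l (pderiv i fun s => φ s a) u) = 0 := by
    ext j
    rw [Pi.zero_apply, ← hS l i j]
    simp only [Matrix.mulVec, dotProduct, Matrix.transpose_apply, jac, Matrix.of_apply, S]
    exact Finset.sum_congr rfl fun a _ => mul_comm _ _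
  have h := congrArg (jac φ u).mulVec hmul
  rw [Matrix.mulVec_mulVec, mul_eq_one_comm.1 (horth u hu), Matrix.one_mulVec,
    Matrix.mulVec_zero] at h
  exact congrFun h a

theorem jac_eq_of_orthogonal {B : Set (Fin 4 → ℂ)} (hB : IsOpen B) (hconn : IsPreconnected B)
    {φ : (Fin 4 → ℂ) → Fin 4 → ℂ} (hφ : AnalyticOnNhd ℂ φ B)
    (horth : ∀ u ∈ B, (jac φ u).transpose * jac φ u = 1) {u v : Fin 4 → ℂ} (hu : u ∈ B)
    (hv : v ∈ B) : jac φ u = jac φ v := by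
  ext a i
  refine hB.is_const_of_fderiv_eq_zero (𝕜 := ℂ) (f := pderiv i fun s => φ s a) hconn
    (fun w hw => (analyticAt_pderiv i
      (analyticAt_coord (hφ w hw) a)).differentiableAt.differentiableWithinAt)
    (fun w hw => ContinuousLinearMap.ext fun x => ?_) hu hv
  rw [fderiv_eq_sum]
  simp [pderiv_pderiv_eq_zero hB hφ horth hw]

theorem mul_transpose_eq_one_of_mul_eq {C M g : Matrix (Fin 4) (Fin 4) ℂ}
    (hM : M * g * M.transpose = 1) (hCM : C * M * g * (C * M).transpose = 1) :
    C * C.transpose = 1 := by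
  rw [← hCM, Matrix.transpose_mul]
  calc C * C.transpose = C * (M * g * M.transpose) * C.transpose := by rw [hM, mul_one]
    _ = _ := by simp only [Matrix.mul_assoc]

theorem IsFlatCoordinates.jac_mul_mul_transpose {F : (Fin 4 → ℂ) → ℂ} {deg : Fin 4 → ℂ} {d : ℂ}
    {V : Set (Fin 4 → ℂ)} {x : (Fin 4 → ℂ) → Fin 4 → ℂ} (hx : IsFlatCoordinates F deg d V x)
    {t : Fin 4 → ℂ} (ht : t ∈ V) :
    jac x t * intersectionForm F deg t * (jac x t).transpose = 1 :=
  (orthonormal_iff F deg x t).1 (hx.orthonormal t ht)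

theorem IsFlatCoordinates.det_jac_ne_zero {F : (Fin 4 → ℂ) → ℂ} {deg : Fin 4 → ℂ} {d : ℂ}
    {V : Set (Fin 4 → ℂ)} {x : (Fin 4 → ℂ) → Fin 4 → ℂ} (hx : IsFlatCoordinates F deg d V x)
    {t : Fin 4 → ℂ} (ht : t ∈ V) : (jac x t).det ≠ 0 := by
  intro h
  have h1 := congrArg Matrix.det (hx.jac_mul_mul_transpose ht)
  rw [Matrix.det_mul, Matrix.det_mul, h, zero_mul, zero_mul, Matrix.det_one] at h1
  exact zero_ne_one h1

theorem IsFlatCoordinates.jac_mulVec {F : (Fin 4 → ℂ) → ℂ} {deg : Fin 4 → ℂ} {d : ℂ}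
    {V : Set (Fin 4 → ℂ)} {x : (Fin 4 → ℂ) → Fin 4 → ℂ} (hx : IsFlatCoordinates F deg d V x)
    {t : Fin 4 → ℂ} (ht : t ∈ V) :
    (jac x t).mulVec (fun k => deg k * t k) = ((1 - d) / 2) • x t := by
  ext i
  rw [Pi.smul_apply, smul_eq_mul, ← hx.euler t ht i]
  simp only [Matrix.mulVec, dotProduct, jac, Matrix.of_apply, mul_comm]

/-- Two systems of flat coordinates differ locally by a constant orthogonal matrix. -/
theorem IsFlatCoordinates.exists_eventually_eq_mulVec {F : (Fin 4 → ℂ) → ℂ} {deg : Fin 4 → ℂ}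
    {d : ℂ} (hd : d ≠ 1) {V : Set (Fin 4 → ℂ)} (hV : IsOpen V)
    {x x' : (Fin 4 → ℂ) → Fin 4 → ℂ} (hx : IsFlatCoordinates F deg d V x)
    (hx' : IsFlatCoordinates F deg d V x') {t₀ : Fin 4 → ℂ} (ht₀ : t₀ ∈ V) :
    ∃ A : Matrix (Fin 4) (Fin 4) ℂ, A * A.transpose = 1 ∧
      ∀ᶠ t in 𝓝 t₀, A.mulVec (x t) = x' t := by
  have ha' := hx'.analytic t₀ ht₀
  obtain ⟨h, hh, hright, hleft⟩ := exists_analytic_localInverse ha' (hx'.det_jac_ne_zero ht₀)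
  have hht₀ : h (x' t₀) = t₀ := hleft.self_of_nhds
  -- The transition map x ∘ x'⁻¹, whose Jacobian carries one orthonormal frame to another.
  let φ (u : Fin 4 → ℂ) : Fin 4 → ℂ := x (h u)
  have hφ : AnalyticAt ℂ φ (x' t₀) :=
    AnalyticAt.comp (g := x) (by rw [hht₀]; exact hx.analytic t₀ ht₀) hh
  have hjac : ∀ᶠ t in 𝓝 t₀, jac x t = jac φ (x' t) * jac x' t := by
    filter_upwards [hleft.eventually_nhds, ha'.continuousAt.eventually hφ.eventually_analyticAt,
      hV.mem_nhds ht₀] with t h₁ h₂ h₃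
    rw [← jac_comp h₂.differentiableAt (hx'.analytic t h₃).differentiableAt]
    exact jac_congr (h₁.mono fun s hs => by simp only [φ, hs])
  have horth : ∀ᶠ u in 𝓝 (x' t₀), AnalyticAt ℂ φ u ∧ (jac φ u).transpose * jac φ u = 1 := by
    have hcont : Tendsto h (𝓝 (x' t₀)) (𝓝 t₀) := by
      have := hh.continuousAt.tendsto
      rwa [hht₀] at this
    filter_upwards [hφ.eventually_analyticAt, hright, hcont.eventually hjac,
      hcont.eventually (hV.mem_nhds ht₀)] with u h₁ h₂ h₃ h₄
    rw [h₂] at h₃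
    refine ⟨h₁, mul_eq_one_comm.1 (mul_transpose_eq_one_of_mul_eq
      (hx'.jac_mul_mul_transpose h₄) ?_)⟩
    rw [← h₃]
    exact hx.jac_mul_mul_transpose h₄
  obtain ⟨ε, hε, hball⟩ := Metric.eventually_nhds_iff_ball.1 horth
  have hconst (u) (hu : u ∈ Metric.ball (x' t₀) ε) : jac φ u = jac φ (x' t₀) :=
    jac_eq_of_orthogonal Metric.isOpen_ball (convex_ball _ _).isPreconnected
      (fun w hw => (hball w hw).1) (fun w hw => (hball w hw).2) hu (Metric.mem_ball_self hε)
  have hC := (hball _ (Metric.mem_ball_self hε)).2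
  refine ⟨(jac φ (x' t₀)).transpose, by rw [Matrix.transpose_transpose, hC], ?_⟩
  filter_upwards [hjac, ha'.continuousAt.eventually (Metric.ball_mem_nhds _ hε),
    hV.mem_nhds ht₀] with t h₁ h₂ h₃
  -- Applying both Jacobians to the Euler field gives x = J x' with no additive constant, because (1
  -- - d)/2 ≠ 0.
  have hxt : x t = (jac φ (x' t₀)).mulVec (x' t) := by
    have e₁ := hx.jac_mulVec h₃
    rw [h₁, hconst _ h₂, ← Matrix.mulVec_mulVec, hx'.jac_mulVec h₃, Matrix.mulVec_smul] at e₁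
    have hne : (1 - d) / 2 ≠ 0 := div_ne_zero (sub_ne_zero.2 hd.symm) two_ne_zero
    exact (smul_right_injective _ hne e₁).symm
  rw [hxt, Matrix.mulVec_mulVec, hC, Matrix.one_mulVec]

theorem IsFlatCoordinates.mono {F : (Fin 4 → ℂ) → ℂ} {deg : Fin 4 → ℂ} {d : ℂ}
    {V W : Set (Fin 4 → ℂ)} {x : (Fin 4 → ℂ) → Fin 4 → ℂ} (hx : IsFlatCoordinates F deg d V x)
    (hWV : W ⊆ V) : IsFlatCoordinates F deg d W x :=
  ⟨fun t ht => hx.analytic t (hWV ht), fun t ht => hx.orthonormal t (hWV ht),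
    fun t ht => hx.euler t (hWV ht)⟩

theorem exists_orthogonal_relations {U V : Set (Fin 4 → ℂ)} {Z : (Fin 4 → ℂ) → ℂ}
    (hU : IsOpen U) (hZ : IsBranch U Z) (hV : IsOpen V) (hconn : IsConnected V) (hVU : V ⊆ U)
    {x : (Fin 4 → ℂ) → Fin 4 → ℂ} (hx : IsFlatCoordinates (prepotential Z) degrees charge V x) :
    ∃ A : Matrix (Fin 4) (Fin 4) ℂ, A * A.transpose = 1 ∧
      ∀ t ∈ V, Relations (A.mulVec (x t)) t (Z t) := by
  obtain ⟨W, hW, ⟨t₀, ht₀⟩, hWV, x', hx', hrel⟩ :=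
    exists_isFlatCoordinates hU hZ hV hconn.nonempty hVU
  obtain ⟨A, hA, hev⟩ := (hx.mono hWV).exists_eventually_eq_mulVec
    (by norm_num [charge]) hW hx' ht₀
  refine ⟨A, hA, fun t ht => relations_iff.2 ?_⟩
  have han : AnalyticOnNhd ℂ (fun t => inv (A.mulVec (x t))) V := fun t ht =>
    AnalyticAt.comp (g := inv) (analyticAt_inv _)
      (AnalyticAt.comp (g := fun v : Fin 4 → ℂ => A.mulVecLin.toContinuousLinearMap v)
        (ContinuousLinearMap.analyticAt _ _) (hx.analytic t ht))
  -- Near t₀ the relations hold because A x is the constructed system; both sides are analytic on V,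
  -- so the identity theorem extends them.
  have heq : (fun t => inv (A.mulVec (x t))) =ᶠ[𝓝 t₀] rel Z := by
    filter_upwards [hev, hW.mem_nhds ht₀] with t h₁ h₂
    rw [h₁]
    exact relations_iff.1 (hrel t h₂)
  exact han.eqOn_of_preconnected_of_eventuallyEq
    (fun t ht => hZ.analyticAt_rel hU (hVU ht)) hconn.isPreconnected (hWV ht₀) heq ht

end AlgFrobenius

end

theorem mainTheorem5 (U : Set (Fin 4 → ℂ)) (hU : IsOpen U) (Z : (Fin 4 → ℂ) → ℂ)
    (hZ : AlgFrobenius.IsBranch U Z) :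
    -- on a dense open part of `U` there are local flat coordinates satisfying the relations
    (∀ V : Set (Fin 4 → ℂ), IsOpen V → V.Nonempty → V ⊆ U →
      ∃ W : Set (Fin 4 → ℂ), IsOpen W ∧ W.Nonempty ∧ W ⊆ V ∧
        ∃ x : (Fin 4 → ℂ) → Fin 4 → ℂ,
          AlgFrobenius.IsFlatCoordinates (AlgFrobenius.prepotential Z) AlgFrobenius.degrees
            AlgFrobenius.charge W x ∧
          ∀ t ∈ W, AlgFrobenius.Relations (x t) t (Z t)) ∧
    -- any flat coordinates on a connected open set satisfy the relations after a fixed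
    -- orthogonal change of the orthonormal frame
    (∀ V : Set (Fin 4 → ℂ), IsOpen V → IsConnected V → V ⊆ U →
      ∀ x : (Fin 4 → ℂ) → Fin 4 → ℂ,
        AlgFrobenius.IsFlatCoordinates (AlgFrobenius.prepotential Z) AlgFrobenius.degrees
          AlgFrobenius.charge V x →
        ∃ A : Matrix (Fin 4) (Fin 4) ℂ, A * A.transpose = 1 ∧
          ∀ t ∈ V, AlgFrobenius.Relations (A.mulVec (x t)) t (Z t)) := by
  exact ⟨fun V hV hne hVU => AlgFrobenius.exists_isFlatCoordinates hU hZ hV hne hVU,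
    fun V hV hconn hVU x hx => AlgFrobenius.exists_orthogonal_relations hU hZ hV hconn hVU hx⟩
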